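/- **Definitions.** All categories below consist of small objects in one fixed universe. A *complete orthomodular lattice* is a complete lattice $P$ with an order-reversing involution $p\mapsto p^\perp$ such that $p\vee p^\perp=1$, $p\wedge p^\perp=0$, and $p\vee(p^\perp\wedge q)=q$ whenever $p\le q$. With functions preserving $\perp$ and arbitrary suprema as morphisms, these form the category $\mathbf{COML}$. A *piecewise complete Boolean algebra* is a set $B$ with a reflexive symmetric relation $\odot$ (commeasurability), a total operation $\neg\colon B\to B$, and an operation $\bigvee$ assigning an element of $B$ to each pairwise commeasurable subset of $B$, such that every pairwise commeasurable $S\subseteq B$ is contained in a *commeasurable subalgebra*, i.e. a pairwise commeasurable $T\subseteq B$ that is a complete Boolean algebra under these operations. Morphisms are functions preserving $\odot$, $\neg$ and $\bigvee$ (of pairwise commeasurable sets); this gives the category $\mathbf{PCBool}$. Let $\le$ be the union of the partial orders of all commeasurable subalgebras of $B$. Call $B$ *transitive* if $\le$ is transitive, and *joined* if every two (not necessarily commeasurable) elements of $B$ have a least upper bound (binary join) with respect to $\le$. An *AW\*-algebra* is a unital C\*-algebra in which the right annihilator of every subset is generated as a right ideal by a projection. A *piecewise C\*-algebra* is a set $A$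 with a reflexive symmetric relation $\odot$, elements $0,1$, total operations ${}^*\colon A\to A$, $\mathbb C\times A\to A$ and $\|\cdot\|\colon A\to\mathbb R$, and sums and products defined on commeasurable pairs, such that every pairwise commeasurable $S\subseteq A$ is contained in a pairwise commeasurable $T\subseteq A$ that is a commutative C\*-algebra (with unit $1$) under these operations. Its projections are $\mathrm{Proj}(A)=\{p\in A: p^*=p=p^2\}$. A *piecewise AW\*-algebra* is a piecewise C\*-algebra $A$ with a function $\mathrm{RP}\colon A\to\mathrm{Proj}(A)$ and an operation $\bigvee$ assigning a projection to each pairwise commeasurable set of projections, such that to every pairwise commeasurable $S\subseteq A$ one can assign a pairwise commeasurable $T(S)\supseteq S$ that is a commutative AW\*-algebra under these operations (with $\mathrm{RP}$ giving right supporting projections and $\bigvee$ giving suprema of projections in $T(S)$), coherently: $S\subseteq S'$ implies $T(S)\subseteq T(S')$. A morphism is a function $f$ that preserves $\odot$, sums and products of commeasurable elements, scalar multiplication, ${}^*$, $1$, and $\bigvee$ of pairwise commeasurable sets of projections. This gives the category $\mathbf{PAW^*}$. The set $\mathrm{Proj}(A)$, with the relation $\odot$, $\neg p=1-p$ and $\bigvee$,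 is a piecewise complete Boolean algebra, and $A$ is called *transitive* (*joined*) if $\mathrm{Proj}(A)$ is. **Proposition.** The following three categories are equivalent: (a) the category $\mathbf{COML}$ of complete orthomodular lattices; (b) the subcategory of $\mathbf{PCBool}$ whose objects are transitive and joined, and whose morphisms preserve binary joins; (c) the subcategory of $\mathbf{PAW^*}$ whose objects are transitive and joined, and whose morphisms preserve binary joins of projections. -/

import Mathlib

open CategoryTheory

universe u

/-! # Complete orthomodular lattices -/

/-- A complete orthomodular lattice: a complete lattice with an order-reversing involution
sending each element to a complement, satisfying the orthomodular law. -/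
class CompleteOrthomodularLattice (P : Type u) extends CompleteLattice P, Compl P where
  compl_anti : ∀ p q : P, p ≤ q → qᶜ ≤ pᶜ
  compl_invol : ∀ p : P, pᶜᶜ = p
  sup_compl : ∀ p : P, p ⊔ pᶜ = ⊤
  inf_compl : ∀ p : P, p ⊓ pᶜ = ⊥
  orthomodular : ∀ p q : P, p ≤ q → p ⊔ (pᶜ ⊓ q) = q

/-- Functions preserving orthocomplements and arbitrary suprema. -/
@[ext]
structure COMLHom (P Q : Type u) [CompleteOrthomodularLattice P]
    [CompleteOrthomodularLattice Q] where
  toFun : P → Q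
  map_compl : ∀ p, toFun pᶜ = (toFun p)ᶜ
  map_sSup : ∀ X : Set P, toFun (sSup X) = sSup (toFun '' X)

/-- Objects of the category of complete orthomodular lattices. -/
structure COML : Type (u + 1) where
  carrier : Type u
  [inst : CompleteOrthomodularLattice carrier]

attribute [instance] COML.inst

instance : Category.{u} COML.{u} where
  Hom P Q := COMLHom P.carrier Q.carrier
  id P :=
    { toFun := fun p => p
      map_compl := fun _ => rfl
      map_sSup := fun X => by rw [Set.image_id'] }
  comp f g :=
    { toFun := fun p => g.toFun (f.toFun p)
      map_compl := fun p => by rw [f.map_compl, g.map_compl]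
      map_sSup := fun X => by rw [f.map_sSup, g.map_sSup, Set.image_image] }

/-! # Piecewise complete Boolean algebras -/

/-- All elements of `X` are pairwise related by `r`. -/
def PairwiseRel {B : Type u} (r : B → B → Prop) (X : Set B) : Prop :=
  ∀ x ∈ X, ∀ y ∈ X, r x y

theorem PairwiseRel.image {B C : Type u} {r : B → B → Prop} {s : C → C → Prop} {f : B → C}
    (hf : ∀ x y, r x y → s (f x) (f y)) {X : Set B} (hX : PairwiseRel r X) :
    PairwiseRel s (f '' X) := by
  rintro _ ⟨x, hx, rfl⟩ _ ⟨y, hy, rfl⟩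
  exact hf x y (hX x hx y hy)

/-- The data of a piecewise complete Boolean algebra: a reflexive symmetric commeasurability
relation, a total negation, and suprema of pairwise commeasurable sets. -/
class PCBData (B : Type u) where
  comm : B → B → Prop
  comm_refl : ∀ x, comm x x
  comm_symm : ∀ x y, comm x y → comm y x
  neg : B → B
  sup : (X : Set B) → PairwiseRel comm X → B

/-- The structure of a commeasurable subalgebra on `T`: the elements of `T` are pairwise
commeasurable, and `T` is a complete Boolean algebra under the operations of `B`
(in particular, `T` is closed under these operations). -/
structure CommeasurableSubalgebra {B : Type u} [PCBData B] (T : Set B) where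
  pairwise_comm : PairwiseRel PCBData.comm T
  alg : CompleteBooleanAlgebra T
  coe_compl : ∀ x : T, ((xᶜ : T) : B) = PCBData.neg (x : B)
  coe_sSup : ∀ (X : Set T) (hX : PairwiseRel PCBData.comm (Subtype.val '' X)),
    ((sSup X : T) : B) = PCBData.sup (Subtype.val '' X) hX

/-- A piecewise complete Boolean algebra. -/
class PiecewiseCBA (B : Type u) extends PCBData B where
  exists_subalgebra : ∀ S : Set B, PairwiseRel comm S →
    ∃ T : Set B, S ⊆ T ∧ Nonempty (CommeasurableSubalgebra T)

section Order

variable {B C : Type u} [PCBData B] [PCBData C]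

/-- The union of the partial orders on the commeasurable subalgebras. -/
def inducedLE (x y : B) : Prop :=
  ∃ (T : Set B) (A : CommeasurableSubalgebra T) (hx : x ∈ T) (hy : y ∈ T),
    A.alg.le ⟨x, hx⟩ ⟨y, hy⟩

/-- `j` is a least upper bound of `x` and `y` for the induced relation. -/
def IsBinaryJoin (x y j : B) : Prop :=
  inducedLE x j ∧ inducedLE y j ∧ ∀ z, inducedLE x z → inducedLE y z → inducedLE j z

variable (B) in
/-- The induced relation is transitive. -/
def IsTransitivePCB : Prop :=
  ∀ x y z : B, inducedLE x y → inducedLE y z → inducedLE x z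

variable (B) in
/-- Every two (not necessarily commeasurable) elements have a least upper bound. -/
def IsJoinedPCB : Prop :=
  ∀ x y : B, ∃ j, IsBinaryJoin x y j

/-- The function `f` preserves binary joins. -/
def PreservesBinaryJoins (f : B → C) : Prop :=
  ∀ x y j : B, IsBinaryJoin x y j → IsBinaryJoin (f x) (f y) (f j)

end Order

/-- Morphisms of piecewise complete Boolean algebras. -/
@[ext]
structure PCBHom (B C : Type u) [PCBData B] [PCBData C] where
  toFun : B → C
  map_comm : ∀ x y, PCBData.comm x y → PCBData.comm (toFun x) (toFun y)
  map_neg : ∀ x, toFun (PCBData.neg x) = PCBData.neg (toFun x)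
  map_sup : ∀ (X : Set B) (hX : PairwiseRel PCBData.comm X),
    toFun (PCBData.sup X hX) = PCBData.sup (toFun '' X) (hX.image map_comm)

/-- Objects of the category of piecewise complete Boolean algebras. -/
structure PCBoolean : Type (u + 1) where
  carrier : Type u
  [inst : PiecewiseCBA carrier]

attribute [instance] PCBoolean.inst

instance : Category.{u} PCBoolean.{u} where
  Hom B C := PCBHom B.carrier C.carrier
  id B :=
    { toFun := fun x => x
      map_comm := fun _ _ h => h
      map_neg := fun _ => rfl
      map_sup := fun X hX => by congr 1; simp }
  comp f g :=
    { toFun := fun x => g.toFun (f.toFun x)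
      map_comm := fun x y h => g.map_comm _ _ (f.map_comm x y h)
      map_neg := fun x => by rw [f.map_neg, g.map_neg]
      map_sup := fun X hX => by
        rw [f.map_sup, g.map_sup]
        congr 1
        rw [Set.image_image] }

/-- Transitive, joined piecewise complete Boolean algebras. -/
structure TJPCBoolean : Type (u + 1) where
  obj : PCBoolean.{u}
  transitive : IsTransitivePCB obj.carrier
  joined : IsJoinedPCB obj.carrier

/-- The morphisms are those of `PCBoolean` that preserve binary joins. -/
instance : Category.{u} TJPCBoolean.{u} where
  Hom B C := {f : B.obj ⟶ C.obj // PreservesBinaryJoins (PCBHom.toFun f)}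
  id B := ⟨𝟙 B.obj, fun _ _ _ h => h⟩
  comp f g := ⟨f.1 ≫ g.1, fun x y j h => g.2 _ _ _ (f.2 x y j h)⟩
  id_comp f := Subtype.ext (Category.id_comp f.1)
  comp_id f := Subtype.ext (Category.comp_id f.1)
  assoc f g h := Subtype.ext (Category.assoc f.1 g.1 h.1)

/-! # Piecewise AW*-algebras -/

/-- A C*-algebra is an AW*-algebra when the right annihilator of each subset is generated, as a
right ideal, by a projection. -/
def IsAWStarAlgebra (A : Type u) [CStarAlgebra A] : Prop :=
  ∀ S : Set A, ∃ p : A, IsStarProjection p ∧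
    {y : A | ∀ x ∈ S, x * y = 0} = {y : A | ∃ z : A, y = p * z}

/-- The data of a piecewise C*-algebra; sums and products are defined only for commeasurable
elements. -/
class PCStarData (A : Type u) where
  comm : A → A → Prop
  comm_refl : ∀ a, comm a a
  comm_symm : ∀ a b, comm a b → comm b a
  zero : A
  one : A
  star : A → A
  smul : ℂ → A → A
  norm : A → ℝ
  add : (a b : A) → comm a b → A
  mul : (a b : A) → comm a b → A

/-- The elements of `T` are pairwise commeasurable, and `T` is a commutative C*-algebra under the
operations of `A` (in particular, `T` is closed under these operations). -/
structure CommeasurableCStarSubalgebra {A : Type u} [PCStarData A] (T : Set A) where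
  pairwise_comm : PairwiseRel PCStarData.comm T
  alg : CommCStarAlgebra T
  coe_zero : ((0 : T) : A) = PCStarData.zero
  coe_one : ((1 : T) : A) = PCStarData.one
  coe_star : ∀ a : T, ((star a : T) : A) = PCStarData.star (a : A)
  coe_smul : ∀ (z : ℂ) (a : T), ((z • a : T) : A) = PCStarData.smul z (a : A)
  coe_norm : ∀ a : T, ‖a‖ = PCStarData.norm (a : A)
  coe_add : ∀ (a b : T) (h : PCStarData.comm (a : A) (b : A)),
    ((a + b : T) : A) = PCStarData.add (a : A) (b : A) h
  coe_mul : ∀ (a b : T) (h : PCStarData.comm (a : A) (b : A)),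
    ((a * b : T) : A) = PCStarData.mul (a : A) (b : A) h

/-- A piecewise C*-algebra. -/
class PiecewiseCStarAlgebra (A : Type u) extends PCStarData A where
  exists_subalgebra : ∀ S : Set A, PairwiseRel comm S →
    ∃ T : Set A, S ⊆ T ∧ Nonempty (CommeasurableCStarSubalgebra T)

/-- The projections: elements `p` with `p* = p = p²`. -/
def PProj (A : Type u) [PCStarData A] : Type u :=
  {p : A // PCStarData.star p = p ∧ PCStarData.mul p p (PCStarData.comm_refl p) = p}

/-- Commeasurability of projections. -/
def PProj.comm {A : Type u} [PCStarData A] (p q : PProj A) : Prop :=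
  PCStarData.comm p.1 q.1

/-- The data of a piecewise AW*-algebra: right supporting projections, and suprema of
pairwise commeasurable sets of projections. -/
class PAWStarData (A : Type u) extends PiecewiseCStarAlgebra A where
  rp : A → PProj A
  sup : (X : Set (PProj A)) → PairwiseRel PProj.comm X → PProj A

/-- The elements of `T` are pairwise commeasurable, and `T` is a commutative AW*-algebra under the
operations of `A`, including right supporting projections and suprema of projections. -/
structure CommeasurableAWStarSubalgebra {A : Type u} [PAWStarData A] (T : Set A) extends
    CommeasurableCStarSubalgebra T where
  isAWStar : IsAWStarAlgebra T
  /-- `rp a` lies in `T` and is the least projection `p` of `T` with `a p = a`. -/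
  rp_spec : ∀ a : T, ∃ p : T, (p : A) = (PAWStarData.rp (a : A)).1 ∧
    IsStarProjection p ∧ a * p = a ∧ ∀ q : T, IsStarProjection q → a * q = a → p = p * q
  /-- For a set `X` of projections of `T`, `sup X` lies in `T` and is the supremum of `X` among the
  projections of `T`, ordered by `p ≤ q ↔ p = p q`. -/
  sup_spec : ∀ (X : Set (PProj A)) (hX : PairwiseRel PProj.comm X), (∀ p ∈ X, p.1 ∈ T) →
    ∃ s : T, (s : A) = (PAWStarData.sup X hX).1 ∧ IsStarProjection s ∧
      (∀ p : T, (∃ x ∈ X, x.1 = (p : A)) → p = p * s) ∧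
      ∀ q : T, IsStarProjection q →
        (∀ p : T, (∃ x ∈ X, x.1 = (p : A)) → p = p * q) → s = s * q

/-- A piecewise AW*-algebra: each pairwise commeasurable set `S` is contained in a commeasurable
commutative AW*-algebra `T S`, and these can be chosen coherently, that is, monotonically in `S`.
Without coherence, one could glue two copies of an infinite-dimensional commutative AW*-algebra
along the linear span of its projections, and the projections would not determine the result. -/
class PiecewiseAWStarAlgebra (A : Type u) extends PAWStarData A where
  exists_subalgebra_mono : ∃ T : (S : Set A) → PairwiseRel PCStarData.comm S → Set A,
    (∀ S hS, S ⊆ T S hS) ∧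
    (∀ S hS, Nonempty (CommeasurableAWStarSubalgebra (T S hS))) ∧
    ∀ S hS S' hS', S ⊆ S' → T S hS ⊆ T S' hS'

section Projections

variable {A : Type u}

theorem PiecewiseCStarAlgebra.exists_mem [PiecewiseCStarAlgebra A] (a : A) :
    ∃ T : Set A, a ∈ T ∧ Nonempty (CommeasurableCStarSubalgebra T) := by
  obtain ⟨T, hT, h⟩ := PiecewiseCStarAlgebra.exists_subalgebra ({a} : Set A) (by
    rintro x rfl y rfl
    exact PCStarData.comm_refl _)
  exact ⟨T, hT rfl, h⟩

theorem PiecewiseCStarAlgebra.comm_one_neg [PiecewiseCStarAlgebra A] (a : A) :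
    PCStarData.comm (PCStarData.one : A) (PCStarData.smul (-1) a) := by
  obtain ⟨T, ha, ⟨h⟩⟩ := PiecewiseCStarAlgebra.exists_mem a
  let _ := h.alg
  rw [← h.coe_one, ← h.coe_smul (-1) ⟨a, ha⟩]
  exact h.pairwise_comm _ (Subtype.prop _) _ (Subtype.prop _)

/-- The element `1 - a`. -/
def PiecewiseCStarAlgebra.oneSub [PiecewiseCStarAlgebra A] (a : A) : A :=
  PCStarData.add PCStarData.one (PCStarData.smul (-1) a)
    (PiecewiseCStarAlgebra.comm_one_neg a)

theorem CommeasurableCStarSubalgebra.coe_oneSub [PiecewiseCStarAlgebra A] {T : Set A}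
    (h : CommeasurableCStarSubalgebra T) (a : T) :
    letI := h.alg
    ((1 - a : T) : A) = PiecewiseCStarAlgebra.oneSub (a : A) := by
  let _ := h.alg
  have e : (1 - a : T) = 1 + (-1 : ℂ) • a := by rw [neg_one_smul, sub_eq_add_neg]
  change ((1 - a : T) : A) = _
  rw [e, h.coe_add _ _ (h.pairwise_comm _ (Subtype.prop _) _ (Subtype.prop _))]
  unfold PiecewiseCStarAlgebra.oneSub
  congr 1
  · exact h.coe_one
  · exact h.coe_smul _ _

/-- The projection `1 - p`. -/
def PProj.neg [PiecewiseCStarAlgebra A] (p : PProj A) : PProj A :=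
  ⟨PiecewiseCStarAlgebra.oneSub p.1, by
    obtain ⟨T, ha, ⟨h⟩⟩ := PiecewiseCStarAlgebra.exists_mem p.1
    let _ := h.alg
    let a : T := ⟨p.1, ha⟩
    have hs : star a = a := Subtype.ext ((h.coe_star a).trans p.2.1)
    have hm : a * a = a :=
      Subtype.ext ((h.coe_mul a a (PCStarData.comm_refl _)).trans p.2.2)
    have e : ((1 - a : T) : A) = PiecewiseCStarAlgebra.oneSub p.1 := h.coe_oneSub a
    constructor
    · rw [← e, ← h.coe_star, star_sub, star_one, hs]
    · have e2 := h.coe_mul (1 - a) (1 - a) (PCStarData.comm_refl _)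
      have e3 : (1 - a) * (1 - a) = 1 - a := by
        rw [sub_mul, one_mul, mul_sub, mul_one, hm, sub_self, sub_zero]
      rw [e3] at e2
      simp only [e] at e2
      exact e2.symm⟩

/-- The projections of a piecewise AW*-algebra, with the operations of a piecewise
complete Boolean algebra. -/
instance [PAWStarData A] : PCBData (PProj A) where
  comm := PProj.comm
  comm_refl p := PCStarData.comm_refl p.1
  comm_symm p q h := PCStarData.comm_symm p.1 q.1 h
  neg := PProj.neg
  sup := PAWStarData.sup

end Projections

/-- The algebraic part of the notion of a morphism of piecewise AW*-algebras. -/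
@[ext]
structure PCStarHom (A B : Type u) [PCStarData A] [PCStarData B] where
  toFun : A → B
  map_comm : ∀ a b, PCStarData.comm a b → PCStarData.comm (toFun a) (toFun b)
  map_one : toFun PCStarData.one = PCStarData.one
  map_mul : ∀ a b (h : PCStarData.comm a b),
    toFun (PCStarData.mul a b h) = PCStarData.mul (toFun a) (toFun b) (map_comm a b h)
  map_add : ∀ a b (h : PCStarData.comm a b),
    toFun (PCStarData.add a b h) = PCStarData.add (toFun a) (toFun b) (map_comm a b h)
  map_smul : ∀ (z : ℂ) (a : A), toFun (PCStarData.smul z a) = PCStarData.smul z (toFun a)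
  map_star : ∀ a, toFun (PCStarData.star a) = PCStarData.star (toFun a)

/-- The restriction of a morphism to projections. -/
def PCStarHom.onProj {A B : Type u} [PCStarData A] [PCStarData B] (f : PCStarHom A B)
    (p : PProj A) : PProj B :=
  ⟨f.toFun p.1, by rw [← f.map_star, p.2.1], by
    rw [← f.map_mul p.1 p.1 (PCStarData.comm_refl p.1), p.2.2]⟩

theorem PCStarHom.onProj_comm {A B : Type u} [PCStarData A] [PCStarData B] (f : PCStarHom A B)
    (p q : PProj A) (h : PProj.comm p q) : PProj.comm (f.onProj p) (f.onProj q) :=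
  f.map_comm p.1 q.1 h

/-- Morphisms of piecewise AW*-algebras. -/
@[ext]
structure PAWStarHom (A B : Type u) [PAWStarData A] [PAWStarData B] extends PCStarHom A B where
  map_sup : ∀ (X : Set (PProj A)) (hX : PairwiseRel PProj.comm X),
    toPCStarHom.onProj (PAWStarData.sup X hX) =
      PAWStarData.sup (toPCStarHom.onProj '' X) (hX.image toPCStarHom.onProj_comm)

/-- Objects of the category of piecewise AW*-algebras. -/
structure PAWStar : Type (u + 1) where
  carrier : Type u
  [inst : PiecewiseAWStarAlgebra carrier]

attribute [instance] PAWStar.inst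

/-- The identity, algebraically. -/
def PCStarHom.id (A : Type u) [PCStarData A] : PCStarHom A A where
  toFun a := a
  map_comm _ _ h := h
  map_one := rfl
  map_mul _ _ _ := rfl
  map_add _ _ _ := rfl
  map_smul _ _ := rfl
  map_star _ := rfl

/-- Composition, algebraically. -/
def PCStarHom.comp {A B C : Type u} [PCStarData A] [PCStarData B] [PCStarData C]
    (g : PCStarHom B C) (f : PCStarHom A B) : PCStarHom A C where
  toFun a := g.toFun (f.toFun a)
  map_comm a b h := g.map_comm _ _ (f.map_comm a b h)
  map_one := by rw [f.map_one, g.map_one]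
  map_mul a b h := by rw [f.map_mul a b h, g.map_mul]
  map_add a b h := by rw [f.map_add a b h, g.map_add]
  map_smul z a := by rw [f.map_smul, g.map_smul]
  map_star a := by rw [f.map_star, g.map_star]

instance : Category.{u} PAWStar.{u} where
  Hom A B := PAWStarHom A.carrier B.carrier
  id A :=
    { PCStarHom.id A.carrier with
      map_sup := fun X hX => by
        change PAWStarData.sup X hX = _
        congr 1
        exact (Set.image_id X).symm }
  comp f g :=
    { g.toPCStarHom.comp f.toPCStarHom with
      map_sup := fun X hX => by
        change g.toPCStarHom.onProj (f.toPCStarHom.onProj (PAWStarData.sup X hX)) = _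
        rw [f.map_sup, g.map_sup]
        congr 1
        exact Set.image_image _ _ _ }

/-- Transitive, joined piecewise AW*-algebras: those whose projections are so. -/
structure TJPAWStar : Type (u + 1) where
  obj : PAWStar.{u}
  transitive : IsTransitivePCB (PProj obj.carrier)
  joined : IsJoinedPCB (PProj obj.carrier)

/-- The morphisms are those of `PAWStar` that preserve binary joins of projections. -/
instance : Category.{u} TJPAWStar.{u} where
  Hom A B := {f : A.obj ⟶ B.obj // PreservesBinaryJoins (PAWStarHom.toPCStarHom f).onProj}
  id A := ⟨𝟙 A.obj, fun _ _ _ h => h⟩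
  comp f g := ⟨f.1 ≫ g.1, fun x y j h => g.2 _ _ _ (f.2 x y j h)⟩
  id_comp f := Subtype.ext (Category.id_comp f.1)
  comp_id f := Subtype.ext (Category.comp_id f.1)
  assoc f g h := Subtype.ext (Category.assoc f.1 g.1 h.1)

/-!
In a complete orthomodular lattice `P`, a set of commuting elements generates a complete Boolean
algebra: its bicommutant is closed under the operations, and the Foulis–Holland theorem makes it
distributive. So `P` is a piecewise complete Boolean algebra, with commutation as commeasurability
and the order of `P` as induced order. Conversely, chains in a piecewise complete Boolean algebra
are commeasurable, hence have suprema. If the induced order is transitive, then suprema of chains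
and binary joins give all suprema by Zorn's lemma. In the resulting orthomodular lattice, commuting
elements `x = (x ⊓ y) ⊔ (x ⊓ yᶜ)` and `y = (x ⊓ y) ⊔ (y ⊓ xᶜ)` are joins of pairwise orthogonal
elements, hence commeasurable.

A commutative AW*-algebra consists of the continuous functions on the Stone space of its
projections. A morphism between the projections of piecewise AW*-algebras thus extends uniquely to
each commeasurable subalgebra, and the coherent choice of subalgebras makes the extensions agree.
The algebra with projections `P` consists of the continuous functions on the Stone spaces of all
commuting subalgebras `R` of `P`. To identify functions from different `R`, encode `a` by the family
of elements of `P` indexed by balls in the plane, whose value at a ball is the closure of the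
preimage of the ball under `a`, a clopen set of the Stone space and so an element of `R`. The family
determines `a`, and `a` factors through the Stone space of any commuting subalgebra that contains
the family.
-/

/-! # Pairwise related sets -/

section PairwiseRel

variable {α : Type u} {r : α → α → Prop} {X : Set α} {x y : α}

theorem PairwiseRel.mono {Y : Set α} (hX : PairwiseRel r X) (h : Y ⊆ X) : PairwiseRel r Y :=
  fun x hx y hy => hX x (h hx) y (h hy)

theorem PairwiseRel.insert (hsymm : ∀ x y, r x y → r y x) (hX : PairwiseRel r X) (hx : r x x)
    (h : ∀ y ∈ X, r x y) : PairwiseRel r (insert x X) := by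
  rintro a (rfl | ha) b (rfl | hb)
  exacts [hx, h b hb, hsymm _ _ (h a ha), hX a ha b hb]

theorem pairwiseRel_empty : PairwiseRel r ∅ := fun _ h => h.elim

theorem pairwiseRel_singleton (hx : r x x) : PairwiseRel r {x} := by
  rintro _ rfl _ rfl
  exact hx

theorem pairwiseRel_pair (hrefl : ∀ x, r x x) (hsymm : ∀ x y, r x y → r y x) (h : r x y) :
    PairwiseRel r {x, y} :=
  (pairwiseRel_singleton (hrefl y)).insert hsymm (hrefl x) fun _ hz => hz ▸ h

theorem pairwiseRel_of_isChain [PartialOrder α] (hsymm : ∀ x y, r x y → r y x)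
    (hle : ∀ x y, x ≤ y → r x y) (hX : IsChain (· ≤ ·) X) : PairwiseRel r X := fun x hx y hy =>
  (hX.total hx hy).elim (hle x y) fun h => hsymm _ _ (hle y x h)

end PairwiseRel

theorem exists_isGreatest_of_chain_closed {α : Type u} [PartialOrder α] {L : Set α}
    (hchain : ∀ c ⊆ L, IsChain (· ≤ ·) c → ∃ s ∈ L, s ∈ upperBounds c)
    (hpair : ∀ x ∈ L, ∀ y ∈ L, ∃ s ∈ L, x ≤ s ∧ y ≤ s) : ∃ m, IsGreatest L m := by
  obtain ⟨m, hm⟩ := zorn_le₀ L hchain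
  refine ⟨m, hm.1, fun l hl => ?_⟩
  obtain ⟨s, hs, hms, hls⟩ := hpair m hm.1 l hl
  exact hls.trans (hm.2 hs hms)

/-! # The order of a piecewise complete Boolean algebra -/

theorem PCBData.sup_congr {B : Type u} [PCBData B] {X Y : Set B} (h : X = Y)
    (hX : PairwiseRel comm X) (hY : PairwiseRel comm Y) : sup X hX = sup Y hY := by
  subst h
  rfl

theorem PCBData.pairwiseRel_pair {B : Type u} [PCBData B] {x y : B} (h : comm x y) :
    PairwiseRel comm {x, y} :=
  _root_.pairwiseRel_pair comm_refl comm_symm h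

namespace CommeasurableSubalgebra

variable {B : Type u} [PCBData B] {T : Set B} (A : CommeasurableSubalgebra T)

/-- The complete Boolean algebra given by a commeasurable subalgebra `A` on `T`. It is a synonym
of `T` that remembers `A`, so that the Boolean operations are found as an instance. -/
def Elem (_ : CommeasurableSubalgebra T) : Type u := T

instance : CompleteBooleanAlgebra A.Elem := A.alg

/-- The inclusion of a commeasurable subalgebra. -/
def val (x : A.Elem) : B := Subtype.val (p := (· ∈ T)) x

variable {A}

theorem val_injective : Function.Injective A.val := Subtype.val_injective

variable (A) in
theorem exists_val_eq {x : B} (hx : x ∈ T) : ∃ a : A.Elem, A.val a = x := ⟨⟨x, hx⟩, rfl⟩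

variable (A) in
theorem exists_image_val_eq {X : Set B} (hX : X ⊆ T) : ∃ Y : Set A.Elem, A.val '' Y = X :=
  ⟨A.val ⁻¹' X, Set.image_preimage_eq_of_subset fun _ hx => A.exists_val_eq (hX hx)⟩

theorem comm_val (x y : A.Elem) : PCBData.comm (A.val x) (A.val y) :=
  A.pairwise_comm _ (Subtype.prop (p := (· ∈ T)) x) _ (Subtype.prop (p := (· ∈ T)) y)

theorem pairwiseRel_image_val (X : Set A.Elem) : PairwiseRel PCBData.comm (A.val '' X) := by
  rintro _ ⟨x, -, rfl⟩ _ ⟨y, -, rfl⟩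
  exact comm_val x y

theorem val_compl (x : A.Elem) : A.val xᶜ = PCBData.neg (A.val x) := A.coe_compl x

theorem val_sSup (X : Set A.Elem) :
    A.val (sSup X) = PCBData.sup (A.val '' X) (pairwiseRel_image_val X) :=
  A.coe_sSup X _

theorem val_sup (x y : A.Elem) :
    A.val (x ⊔ y) = PCBData.sup {A.val x, A.val y} (PCBData.pairwiseRel_pair (comm_val x y)) := by
  rw [← sSup_pair, val_sSup]
  exact PCBData.sup_congr (Set.image_pair _ _ _) _ _

theorem exists_sup_eq_of_inducedLE {x y : B} (h : inducedLE x y) :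
    ∃ hxy : PairwiseRel PCBData.comm {x, y}, PCBData.sup {x, y} hxy = y := by
  obtain ⟨T, A, hx, hy, h⟩ := h
  exact ⟨_, (val_sup (A := A) ⟨x, hx⟩ ⟨y, hy⟩).symm.trans (congrArg A.val (sup_eq_right.2 h))⟩

theorem inducedLE_val {x y : A.Elem} : inducedLE (A.val x) (A.val y) ↔ x ≤ y := by
  refine ⟨fun h => ?_, fun h => ⟨T, A, Subtype.prop _, Subtype.prop _, h⟩⟩
  obtain ⟨_, h⟩ := exists_sup_eq_of_inducedLE h
  exact sup_eq_right.1 (val_injective ((val_sup x y).trans h))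

end CommeasurableSubalgebra

namespace PiecewiseCBA

open CommeasurableSubalgebra

section

variable {B : Type u} [PCBData B] {x y : B}

theorem exists_val_eq_of_le (h : inducedLE x y) :
    ∃ (T : Set B) (A : CommeasurableSubalgebra T) (a b : A.Elem),
      a ≤ b ∧ A.val a = x ∧ A.val b = y := by
  obtain ⟨T, A, hx, hy, h⟩ := h
  exact ⟨T, A, ⟨x, hx⟩, ⟨y, hy⟩, h, rfl, rfl⟩

theorem comm_of_le (h : inducedLE x y) : PCBData.comm x y := by
  obtain ⟨T, A, a, b, -, rfl, rfl⟩ := exists_val_eq_of_le h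
  exact comm_val a b

theorem neg_anti (h : inducedLE x y) : inducedLE (PCBData.neg y) (PCBData.neg x) := by
  obtain ⟨T, A, a, b, hab, rfl, rfl⟩ := exists_val_eq_of_le h
  rw [← val_compl, ← val_compl, inducedLE_val]
  exact compl_le_compl hab

theorem le_antisymm (h : inducedLE x y) (h' : inducedLE y x) : x = y := by
  obtain ⟨T, A, a, b, hab, rfl, rfl⟩ := exists_val_eq_of_le h
  exact congrArg A.val (hab.antisymm (inducedLE_val.1 h'))

end

variable {B : Type u} [PiecewiseCBA B] {x y : B}

theorem exists_val_eq_of_comm (h : PCBData.comm x y) :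
    ∃ (T : Set B) (A : CommeasurableSubalgebra T) (a b : A.Elem), A.val a = x ∧ A.val b = y := by
  obtain ⟨T, hT, ⟨A⟩⟩ := exists_subalgebra _ (PCBData.pairwiseRel_pair h)
  exact ⟨T, A, ⟨x, hT (by simp)⟩, ⟨y, hT (by simp)⟩, rfl, rfl⟩

theorem exists_val_eq (x : B) :
    ∃ (T : Set B) (A : CommeasurableSubalgebra T) (a : A.Elem), A.val a = x := by
  obtain ⟨T, A, a, -, ha, -⟩ := exists_val_eq_of_comm (PCBData.comm_refl x)
  exact ⟨T, A, a, ha⟩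

theorem exists_image_val_eq_of_comm {S : Set B} (hS : PairwiseRel PCBData.comm S) :
    ∃ (T : Set B) (A : CommeasurableSubalgebra T) (X : Set A.Elem), A.val '' X = S := by
  obtain ⟨T, hT, ⟨A⟩⟩ := exists_subalgebra S hS
  exact ⟨T, A, A.exists_image_val_eq hT⟩

theorem le_iff :
    inducedLE x y ↔ ∃ h : PairwiseRel PCBData.comm {x, y}, PCBData.sup {x, y} h = y := by
  refine ⟨exists_sup_eq_of_inducedLE, fun ⟨h, e⟩ => ?_⟩
  obtain ⟨T, A, a, b, rfl, rfl⟩ := exists_val_eq_of_comm (h x (by simp) y (by simp))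
  rw [inducedLE_val, ← sup_eq_right]
  exact val_injective ((val_sup a b).trans e)

theorem le_refl (x : B) : inducedLE x x := by
  obtain ⟨T, A, a, rfl⟩ := exists_val_eq x
  exact inducedLE_val.2 le_rfl

theorem neg_neg (x : B) : PCBData.neg (PCBData.neg x) = x := by
  obtain ⟨T, A, a, rfl⟩ := exists_val_eq x
  rw [← val_compl, ← val_compl, compl_compl]

theorem comm_neg (h : PCBData.comm x y) : PCBData.comm x (PCBData.neg y) := by
  obtain ⟨T, A, a, b, rfl, rfl⟩ := exists_val_eq_of_comm h
  exact val_compl b ▸ comm_val a bᶜ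

theorem comm_of_le_neg (h : inducedLE x (PCBData.neg y)) : PCBData.comm x y :=
  neg_neg y ▸ comm_neg (comm_of_le h)

theorem le_sup {X : Set B} (hX : PairwiseRel PCBData.comm X) (hx : x ∈ X) :
    inducedLE x (PCBData.sup X hX) := by
  obtain ⟨T, A, X, rfl⟩ := exists_image_val_eq_of_comm hX
  obtain ⟨a, ha, rfl⟩ := hx
  rw [← val_sSup, inducedLE_val]
  exact le_sSup ha

theorem sup_le {X : Set B} (hX : PairwiseRel PCBData.comm X) {z : B}
    (hz : ∀ x ∈ X, inducedLE x z) : inducedLE (PCBData.sup X hX) z := by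
  have hzX : PairwiseRel PCBData.comm (insert z X) :=
    hX.insert PCBData.comm_symm (PCBData.comm_refl z) fun x hx =>
      PCBData.comm_symm _ _ (comm_of_le (hz x hx))
  obtain ⟨T, hT, ⟨A⟩⟩ := exists_subalgebra _ hzX
  obtain ⟨c, rfl⟩ := A.exists_val_eq (hT (Set.mem_insert z X))
  obtain ⟨X, rfl⟩ := A.exists_image_val_eq ((Set.subset_insert _ X).trans hT)
  rw [← val_sSup, inducedLE_val]
  exact sSup_le fun a ha => inducedLE_val.1 (hz _ ⟨a, ha, rfl⟩)

end PiecewiseCBA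

theorem PCBHom.map_le {B C : Type u} [PCBData B] [PiecewiseCBA C] (f : PCBHom B C) {x y : B}
    (h : inducedLE x y) : inducedLE (f.toFun x) (f.toFun y) := by
  obtain ⟨hxy, e⟩ := CommeasurableSubalgebra.exists_sup_eq_of_inducedLE h
  have himage : f.toFun '' {x, y} = {f.toFun x, f.toFun y} := Set.image_pair _ _ _
  refine PiecewiseCBA.le_iff.2 ⟨himage ▸ hxy.image f.map_comm, ?_⟩
  conv_rhs => rw [← e, f.map_sup]
  exact PCBData.sup_congr himage.symm _ _

/-! # Commutation in complete orthomodular lattices -/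

namespace CompleteOrthomodularLattice

variable {P : Type u} [CompleteOrthomodularLattice P] {p q : P}

theorem compl_le_compl (h : p ≤ q) : qᶜ ≤ pᶜ := compl_anti p q h

theorem le_compl_comm (h : p ≤ qᶜ) : q ≤ pᶜ := by
  simpa only [compl_invol] using compl_le_compl h

theorem compl_sSup (X : Set P) : (sSup X)ᶜ = ⨅ x ∈ X, xᶜ :=
  le_antisymm (le_iInf₂ fun _ hx => compl_le_compl (le_sSup hx))
    (le_compl_comm (sSup_le fun x hx => le_compl_comm (iInf₂_le x hx)))

theorem compl_sup (p q : P) : (p ⊔ q)ᶜ = pᶜ ⊓ qᶜ := by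
  rw [← sSup_pair, compl_sSup, iInf_pair]

theorem compl_inf (p q : P) : (p ⊓ q)ᶜ = pᶜ ⊔ qᶜ := by
  rw [← compl_invol (pᶜ ⊔ qᶜ), compl_sup, compl_invol, compl_invol]

theorem compl_sInf (X : Set P) : (sInf X)ᶜ = sSup (compl '' X) := by
  rw [← compl_invol (sSup _), compl_sSup, iInf_image, sInf_eq_iInf]
  simp only [compl_invol]

/-- Commutation of two elements of an orthomodular lattice, which is symmetric by the
orthomodular law. -/
def Commutes (p q : P) : Prop := p = (p ⊓ q) ⊔ (p ⊓ qᶜ)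

theorem commutes_of_le_sup (h : p ≤ (p ⊓ q) ⊔ (p ⊓ qᶜ)) : Commutes p q :=
  h.antisymm (sup_le inf_le_left inf_le_left)

theorem commutes_of_le (h : p ≤ q) : Commutes p q :=
  commutes_of_le_sup (by rw [inf_eq_left.2 h]; exact le_sup_left)

theorem commutes_refl (p : P) : Commutes p p := commutes_of_le le_rfl

namespace Commutes

theorem compl_right (h : Commutes p q) : Commutes p qᶜ := by
  unfold Commutes at *
  rwa [compl_invol, sup_comm]

theorem sup_compl_inf_le (h : Commutes p q) : (pᶜ ⊔ qᶜ) ⊓ q ≤ pᶜ := by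
  have : pᶜ = (pᶜ ⊔ qᶜ) ⊓ (pᶜ ⊔ q) := by
    conv_lhs => rw [h, compl_sup, compl_inf, compl_inf, compl_invol]
  conv_rhs => rw [this]
  exact inf_le_inf_left _ le_sup_right

theorem symm (h : Commutes p q) : Commutes q p := by
  apply commutes_of_le_sup
  conv_lhs => rw [← orthomodular (p ⊓ q) q inf_le_right, compl_inf]
  refine sup_le (le_sup_of_le_left (inf_comm p q).le) (le_sup_of_le_right ?_)
  exact le_inf inf_le_right h.sup_compl_inf_le

theorem sSup_left {X : Set P} (h : ∀ q ∈ X, Commutes q p) : Commutes (sSup X) p := by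
  refine commutes_of_le_sup (sSup_le fun q hq => ?_)
  conv_lhs => rw [h q hq]
  exact sup_le_sup (inf_le_inf_right _ (le_sSup hq)) (inf_le_inf_right _ (le_sSup hq))

/-- The Foulis–Holland theorem. -/
theorem inf_sSup {X : Set P} (h : ∀ q ∈ X, Commutes p q) : p ⊓ sSup X = ⨆ q ∈ X, p ⊓ q := by
  set s := ⨆ q ∈ X, p ⊓ q
  have hle : s ≤ p ⊓ sSup X := iSup₂_le fun q hq => inf_le_inf_left _ (le_sSup hq)
  have hcompl : sᶜ ⊓ p ≤ (sSup X)ᶜ := by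
    rw [compl_sSup]
    refine le_iInf₂ fun q hq => ?_
    have : sᶜ ≤ qᶜ ⊔ pᶜ := by
      rw [sup_comm, ← compl_inf]
      exact compl_le_compl (le_iSup₂_of_le q hq le_rfl)
    exact (inf_le_inf_right _ this).trans (h q hq).symm.sup_compl_inf_le
  rw [← orthomodular s _ hle, sup_eq_left]
  refine le_trans ?_ bot_le
  rw [← inf_compl (sSup X)]
  exact le_inf (inf_le_right.trans inf_le_right) ((inf_le_inf_left _ inf_le_left).trans hcompl)

end Commutes

/-- The elements commuting with all elements of `S`. -/
def commutant (S : Set P) : Set P := {p | ∀ q ∈ S, Commutes p q}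

theorem commutant_anti {S S' : Set P} (h : S ⊆ S') : commutant S' ⊆ commutant S :=
  fun _ hp _ hq => hp _ (h hq)

theorem subset_bicommutant (S : Set P) : S ⊆ commutant (commutant S) :=
  fun _ hp _ hq => (hq _ hp).symm

theorem commutant_tricommutant (S : Set P) :
    commutant (commutant (commutant S)) = commutant S :=
  (commutant_anti (subset_bicommutant S)).antisymm (subset_bicommutant _)

theorem compl_mem_commutant {S : Set P} (h : p ∈ commutant S) : pᶜ ∈ commutant S :=
  fun q hq => (h q hq).symm.compl_right.symm

theorem sSup_mem_commutant {S X : Set P} (h : X ⊆ commutant S) : sSup X ∈ commutant S :=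
  fun q hq => Commutes.sSup_left fun _ hx => h hx q hq

variable (P) in
/-- A commuting subalgebra of an orthomodular lattice: a set of pairwise commuting elements that
contains its bicommutant. It is then a complete Boolean algebra under the operations of `P`. -/
structure CommutingSubalgebra where
  carrier : Set P
  commutes : PairwiseRel Commutes carrier
  bicommutant_subset : commutant (commutant carrier) ⊆ carrier

namespace CommutingSubalgebra

instance : SetLike (CommutingSubalgebra P) P where
  coe := carrier
  coe_injective R R' h := by cases R; cases R'; congr

instance : PartialOrder (CommutingSubalgebra P) := .ofSetLike (CommutingSubalgebra P) P

/-- The least commuting subalgebra containing a set of pairwise commuting elements. -/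
def generate (S : Set P) (hS : PairwiseRel Commutes S) : CommutingSubalgebra P where
  carrier := commutant (commutant S)
  commutes _ hp q hq := hp q (commutant_anti hS hq)
  bicommutant_subset := by rw [commutant_tricommutant]

theorem subset_generate {S : Set P} (hS : PairwiseRel Commutes S) : S ⊆ generate S hS :=
  subset_bicommutant S

variable (R : CommutingSubalgebra P)

theorem bicommutant_eq : commutant (commutant (R : Set P)) = R :=
  R.bicommutant_subset.antisymm (subset_bicommutant _)

theorem generate_le {R : CommutingSubalgebra P} {S : Set P} {hS : PairwiseRel Commutes S} :
    generate S hS ≤ R ↔ S ⊆ R := by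
  refine ⟨(subset_generate hS).trans, fun h => ?_⟩
  change commutant (commutant S) ⊆ (R : Set P)
  rw [← R.bicommutant_eq]
  exact commutant_anti (commutant_anti h)

theorem compl_mem (h : p ∈ R) : pᶜ ∈ R :=
  R.bicommutant_subset (compl_mem_commutant (subset_bicommutant _ h))

theorem sSup_mem {X : Set P} (h : X ⊆ R) : sSup X ∈ R :=
  R.bicommutant_subset (sSup_mem_commutant (h.trans (subset_bicommutant _)))

theorem sInf_mem {X : Set P} (h : X ⊆ R) : sInf X ∈ R := by
  rw [← compl_invol (sInf X), compl_sInf]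
  refine R.compl_mem (R.sSup_mem ?_)
  rintro _ ⟨x, hx, rfl⟩
  exact R.compl_mem (h hx)

/-- A commuting subalgebra as a complete sublattice. -/
def toCompleteSublattice : CompleteSublattice P :=
  .mk' R.carrier (fun _ h => R.sSup_mem h) (fun _ h => R.sInf_mem h)

instance : CompleteLattice R := inferInstanceAs (CompleteLattice R.toCompleteSublattice)

instance : Compl R := ⟨fun p => ⟨p.1ᶜ, R.compl_mem p.2⟩⟩

variable {R}

theorem inf_sup_le (p q r : R) : p ⊓ (q ⊔ r) ≤ (p ⊓ q) ⊔ (p ⊓ r) := by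
  have h : ∀ s ∈ ({q.1, r.1} : Set P), Commutes p.1 s := by
    rintro _ (rfl | rfl)
    exacts [R.commutes _ p.2 _ q.2, R.commutes _ p.2 _ r.2]
  change p.1 ⊓ (q.1 ⊔ r.1) ≤ (p.1 ⊓ q.1) ⊔ (p.1 ⊓ r.1)
  rw [← sSup_pair, Commutes.inf_sSup h, iSup_pair]

instance : CompleteBooleanAlgebra R :=
  { (inferInstance : CompleteLattice R), DistribLattice.ofInfSupLe (inf_sup_le (R := R)) with
    compl := compl
    inf_compl_le_bot p := (CompleteOrthomodularLattice.inf_compl p.1).le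
    top_le_sup_compl p := (CompleteOrthomodularLattice.sup_compl p.1).ge }

end CommutingSubalgebra

end CompleteOrthomodularLattice

/-! # Complete orthomodular lattices as piecewise complete Boolean algebras -/

section COML

open CompleteOrthomodularLattice CommutingSubalgebra

/-- The operations of a complete orthomodular lattice that make it a piecewise complete Boolean
algebra, with commutation as commeasurability. -/
@[reducible] def CompleteOrthomodularLattice.toPCBData (P : Type u)
    [CompleteOrthomodularLattice P] : PCBData P where
  comm := Commutes
  comm_refl := commutes_refl
  comm_symm _ _ h := h.symm
  neg := compl
  sup X _ := sSup X

/-- A complete orthomodular lattice as a piecewise complete Boolean algebra. -/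
@[reducible] def CompleteOrthomodularLattice.toPiecewiseCBA (P : Type u)
    [CompleteOrthomodularLattice P] : PiecewiseCBA P :=
  letI := toPCBData P
  { toPCBData P with
    exists_subalgebra := fun S hS =>
      ⟨generate S hS, subset_generate hS, ⟨{
        pairwise_comm := (generate S hS).commutes
        alg := inferInstanceAs (CompleteBooleanAlgebra (generate S hS))
        coe_compl := fun _ => rfl
        coe_sSup := fun _ _ => rfl }⟩⟩ }

attribute [local instance] toPiecewiseCBA

namespace CompleteOrthomodularLattice

variable {P : Type u} [CompleteOrthomodularLattice P]

theorem inducedLE_iff {p q : P} : inducedLE p q ↔ p ≤ q := by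
  have h : (∃ _ : PairwiseRel Commutes {p, q}, sSup {p, q} = q) ↔ p ≤ q := by
    rw [sSup_pair, sup_eq_right]
    exact ⟨fun h => h.2, fun h =>
      ⟨pairwiseRel_pair commutes_refl (fun _ _ => Commutes.symm) (commutes_of_le h), h⟩⟩
  exact PiecewiseCBA.le_iff.trans h

theorem isBinaryJoin_iff {p q j : P} : IsBinaryJoin p q j ↔ j = p ⊔ q := by
  simp only [IsBinaryJoin, inducedLE_iff]
  constructor
  · rintro ⟨hp, hq, hj⟩
    exact (hj _ le_sup_left le_sup_right).antisymm (sup_le hp hq)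
  · rintro rfl
    exact ⟨le_sup_left, le_sup_right, fun _ => sup_le⟩

theorem isTransitivePCB : IsTransitivePCB P := fun _ _ _ h h' =>
  inducedLE_iff.2 ((inducedLE_iff.1 h).trans (inducedLE_iff.1 h'))

theorem isJoinedPCB : IsJoinedPCB P := fun _ _ => ⟨_, isBinaryJoin_iff.2 rfl⟩

variable {Q : Type u} [CompleteOrthomodularLattice Q]

theorem preservesBinaryJoins_iff {f : P → Q} :
    PreservesBinaryJoins f ↔ ∀ p q, f (p ⊔ q) = f p ⊔ f q := by
  simp only [PreservesBinaryJoins, isBinaryJoin_iff]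
  exact ⟨fun h p q => h p q _ rfl, fun h p q j hj => hj ▸ h p q⟩

/-- Suprema of chains, whose elements commute, and binary joins generate all suprema. -/
theorem map_sSup_of_commuting {f : P → Q} (hsup : ∀ p q, f (p ⊔ q) = f p ⊔ f q)
    (hcomm : ∀ X : Set P, PairwiseRel Commutes X → f (sSup X) = sSup (f '' X)) (X : Set P) :
    f (sSup X) = sSup (f '' X) := by
  have hmono : Monotone f := fun p q h => by
    rw [← sup_eq_right.2 h, hsup]
    exact le_sup_left
  obtain ⟨m, hm, hmax⟩ : ∃ m, IsGreatest {p | f p ≤ sSup (f '' X)} m := by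
    refine exists_isGreatest_of_chain_closed (fun c hc hchain => ⟨sSup c, ?_, fun x => le_sSup⟩)
      fun p hp q hq => ⟨p ⊔ q, (hsup p q).le.trans (sup_le hp hq), le_sup_left, le_sup_right⟩
    have hcc : PairwiseRel Commutes c :=
      pairwiseRel_of_isChain (fun _ _ => Commutes.symm) (fun _ _ => commutes_of_le) hchain
    refine (hcomm c hcc).trans_le (sSup_le ?_)
    rintro _ ⟨p, hp, rfl⟩
    exact hc hp
  refine le_antisymm ?_ (sSup_le (by rintro _ ⟨x, hx, rfl⟩; exact hmono (le_sSup hx)))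
  exact (hmono (sSup_le fun x hx => hmax (le_sSup (Set.mem_image_of_mem f hx)))).trans hm

end CompleteOrthomodularLattice

namespace COMLHom

variable {P Q : Type u} [CompleteOrthomodularLattice P] [CompleteOrthomodularLattice Q]
  (f : COMLHom P Q)

theorem map_sup (p q : P) : f.toFun (p ⊔ q) = f.toFun p ⊔ f.toFun q := by
  rw [← sSup_pair, f.map_sSup, Set.image_pair, sSup_pair]

theorem map_inf (p q : P) : f.toFun (p ⊓ q) = f.toFun p ⊓ f.toFun q := by
  rw [← compl_invol (p ⊓ q), CompleteOrthomodularLattice.compl_inf, f.map_compl, map_sup,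
    f.map_compl, f.map_compl, ← CompleteOrthomodularLattice.compl_inf, compl_invol]

theorem map_commutes {p q : P} (h : Commutes p q) : Commutes (f.toFun p) (f.toFun q) := by
  unfold Commutes
  conv_lhs => rw [h]
  rw [map_sup, map_inf, map_inf, f.map_compl]

/-- A morphism of complete orthomodular lattices as one of piecewise complete Boolean algebras. -/
def toPCBHom : PCBHom P Q where
  toFun := f.toFun
  map_comm _ _ := f.map_commutes
  map_neg := f.map_compl
  map_sup X _ := f.map_sSup X

end COMLHom

/-- The transitive joined piecewise complete Boolean algebra of a complete orthomodular
lattice. -/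
def COML.toTJPCBoolean (P : COML.{u}) : TJPCBoolean.{u} where
  obj := ⟨P.carrier⟩
  transitive := isTransitivePCB
  joined := isJoinedPCB

/-- The functor regarding complete orthomodular lattices as piecewise complete Boolean
algebras. -/
def comlToTJPCBoolean : COML.{u} ⥤ TJPCBoolean.{u} where
  obj := COML.toTJPCBoolean
  map {P Q} f :=
    let f : COMLHom P.carrier Q.carrier := f
    ⟨f.toPCBHom, (preservesBinaryJoins_iff (P := P.carrier) (Q := Q.carrier)).2 f.map_sup⟩

instance : comlToTJPCBoolean.{u}.Faithful where
  map_injective h := COMLHom.ext (congrArg (fun k => PCBHom.toFun k.1) h)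

instance : comlToTJPCBoolean.{u}.Full where
  map_surjective {P Q} f := by
    let g : PCBHom P.carrier Q.carrier := f.1
    have hg : ∀ p q, g.toFun (p ⊔ q) = g.toFun p ⊔ g.toFun q :=
      (preservesBinaryJoins_iff (P := P.carrier) (Q := Q.carrier)).1 f.2
    let h : COMLHom P.carrier Q.carrier := ⟨g.toFun, g.map_neg, map_sSup_of_commuting hg g.map_sup⟩
    exact ⟨h, rfl⟩

end COML

/-! # Transitive joined piecewise complete Boolean algebras as orthomodular lattices -/

namespace TJPCBoolean

open CommeasurableSubalgebra CompleteOrthomodularLattice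

section Lattice

variable (B : TJPCBoolean.{u})

scoped instance : PartialOrder B.obj.carrier where
  le := inducedLE
  le_refl := PiecewiseCBA.le_refl
  le_trans := B.transitive
  le_antisymm _ _ := PiecewiseCBA.le_antisymm

variable {B}

theorem isLUB_sup {X : Set B.obj.carrier} (hX : PairwiseRel PCBData.comm X) :
    IsLUB X (PCBData.sup X hX) :=
  ⟨fun _ hx => PiecewiseCBA.le_sup hX hx, fun _ hz => PiecewiseCBA.sup_le hX hz⟩

theorem comm_of_le {x y : B.obj.carrier} (h : x ≤ y) : PCBData.comm x y :=
  PiecewiseCBA.comm_of_le h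

/-- The supremum of `S` is the greatest element of the set of lower bounds of the upper bounds of
`S`, which is closed under the suprema of its chains and of its pairs. -/
theorem exists_isLUB (S : Set B.obj.carrier) : ∃ s, IsLUB S s := by
  obtain ⟨m, hm⟩ : ∃ m, IsGreatest (lowerBounds (upperBounds S)) m := by
    refine exists_isGreatest_of_chain_closed (fun c hc hchain => ?_) fun x hx y hy => ?_
    · have hcc : PairwiseRel PCBData.comm c :=
        pairwiseRel_of_isChain PCBData.comm_symm (fun _ _ => comm_of_le) hchain
      exact ⟨_, fun u hu => (isLUB_sup hcc).2 fun x hx => hc hx hu, (isLUB_sup hcc).1⟩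
    · obtain ⟨j, hxj, hyj, hj⟩ := B.joined x y
      exact ⟨j, fun u hu => hj u (hx hu) (hy hu), hxj, hyj⟩
  exact ⟨m, fun x hx => hm.2 fun u hu => hu hx, hm.1⟩

noncomputable scoped instance : CompleteLattice B.obj.carrier :=
  letI : SupSet B.obj.carrier := ⟨fun S => (exists_isLUB S).choose⟩
  completeLatticeOfSup _ fun S => (exists_isLUB S).choose_spec

theorem sup_eq_sSup {X : Set B.obj.carrier} (hX : PairwiseRel PCBData.comm X) :
    PCBData.sup X hX = sSup X :=
  (isLUB_sup hX).unique (isLUB_sSup X)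

scoped instance : Compl B.obj.carrier := ⟨PCBData.neg⟩

theorem compl_compl (x : B.obj.carrier) : xᶜᶜ = x := PiecewiseCBA.neg_neg x

theorem compl_anti {x y : B.obj.carrier} (h : x ≤ y) : yᶜ ≤ xᶜ := PiecewiseCBA.neg_anti h

section Subalgebra

variable {T : Set B.obj.carrier} {A : CommeasurableSubalgebra T}

theorem val_le_val {a b : A.Elem} : A.val a ≤ A.val b ↔ a ≤ b := inducedLE_val

theorem val_compl (a : A.Elem) : A.val aᶜ = (A.val a)ᶜ := CommeasurableSubalgebra.val_compl a

theorem val_sSup (X : Set A.Elem) : A.val (sSup X) = sSup (A.val '' X) :=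
  (CommeasurableSubalgebra.val_sSup X).trans (sup_eq_sSup _)

theorem val_sup (a b : A.Elem) : A.val (a ⊔ b) = A.val a ⊔ A.val b := by
  rw [← sSup_pair, val_sSup, Set.image_pair, sSup_pair]

theorem val_inf (a b : A.Elem) : A.val (a ⊓ b) = A.val a ⊓ A.val b := by
  refine le_antisymm (le_inf (val_le_val.2 inf_le_left) (val_le_val.2 inf_le_right)) ?_
  have h : aᶜ ⊔ bᶜ = (a ⊓ b)ᶜ := compl_inf.symm
  rw [← compl_compl (A.val a ⊓ A.val b), ← compl_compl (A.val (a ⊓ b)), ← val_compl (a ⊓ b), ← h,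
    val_sup, val_compl, val_compl]
  exact compl_anti (sup_le (compl_anti inf_le_left) (compl_anti inf_le_right))

theorem val_bot : A.val ⊥ = ⊥ := by
  rw [← sSup_empty, val_sSup, Set.image_empty, sSup_empty]

theorem val_top : A.val ⊤ = ⊤ := by
  refine top_le_iff.1 ?_
  rw [← compl_compl ⊤, ← _root_.compl_bot, val_compl, val_bot]
  exact compl_anti bot_le

end Subalgebra

noncomputable scoped instance : CompleteOrthomodularLattice B.obj.carrier where
  compl_anti _ _ := compl_anti
  compl_invol := compl_compl
  sup_compl p := by
    obtain ⟨T, A, a, rfl⟩ := PiecewiseCBA.exists_val_eq p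
    rw [← val_compl, ← val_sup, sup_compl_eq_top, val_top]
  inf_compl p := by
    obtain ⟨T, A, a, rfl⟩ := PiecewiseCBA.exists_val_eq p
    rw [← val_compl, ← val_inf, inf_compl_eq_bot, val_bot]
  orthomodular p q h := by
    obtain ⟨T, A, a, b, hab, rfl, rfl⟩ := PiecewiseCBA.exists_val_eq_of_le h
    rw [← val_compl, ← val_inf, ← val_sup, sup_inf_left, sup_compl_eq_top, top_inf_eq,
      sup_eq_right.2 hab]

theorem comm_of_le_compl {x y : B.obj.carrier} (h : x ≤ yᶜ) : PCBData.comm x y :=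
  PiecewiseCBA.comm_of_le_neg h

theorem comm_sup_sup_of_le_compl {x y z : B.obj.carrier} (hxy : x ≤ yᶜ) (hxz : x ≤ zᶜ)
    (hyz : y ≤ zᶜ) : PCBData.comm (x ⊔ y) (x ⊔ z) := by
  have hS : PairwiseRel PCBData.comm {x, y, z} :=
    (PCBData.pairwiseRel_pair (comm_of_le_compl hyz)).insert PCBData.comm_symm
      (PCBData.comm_refl x) (by
        rintro _ (rfl | rfl)
        exacts [comm_of_le_compl hxy, comm_of_le_compl hxz])
  obtain ⟨T, hT, ⟨A⟩⟩ := PiecewiseCBA.exists_subalgebra _ hS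
  obtain ⟨a, rfl⟩ := A.exists_val_eq (hT (by simp : x ∈ _))
  obtain ⟨b, rfl⟩ := A.exists_val_eq (hT (by simp : y ∈ _))
  obtain ⟨c, rfl⟩ := A.exists_val_eq (hT (by simp : z ∈ _))
  rw [← val_sup, ← val_sup]
  exact comm_val _ _

theorem comm_iff_commutes {x y : B.obj.carrier} : PCBData.comm x y ↔ Commutes x y := by
  constructor
  · intro h
    obtain ⟨T, A, a, b, rfl, rfl⟩ := PiecewiseCBA.exists_val_eq_of_comm h
    rw [Commutes, ← val_compl, ← val_inf, ← val_inf, ← val_sup, ← inf_sup_left, sup_compl_eq_top,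
      inf_top_eq]
  · intro h
    have hy : y = (x ⊓ y) ⊔ (y ⊓ xᶜ) := inf_comm y x ▸ h.symm
    have hcomm : PCBData.comm ((x ⊓ y) ⊔ (x ⊓ yᶜ)) ((x ⊓ y) ⊔ (y ⊓ xᶜ)) :=
      comm_sup_sup_of_le_compl (inf_le_right.trans (le_compl_comm inf_le_right))
        (inf_le_left.trans (le_compl_comm inf_le_right))
        (inf_le_left.trans (le_compl_comm inf_le_right))
    rwa [← h, ← hy] at hcomm

theorem isBinaryJoin_iff {x y j : B.obj.carrier} : IsBinaryJoin x y j ↔ j = x ⊔ y := by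
  constructor
  · rintro ⟨hx, hy, hj⟩
    exact le_antisymm (hj _ (le_sup_left (a := x)) (le_sup_right (a := x))) (sup_le hx hy)
  · rintro rfl
    exact ⟨le_sup_left (a := x), le_sup_right (a := x), fun _ => sup_le (a := x)⟩

end Lattice

variable {B C : TJPCBoolean.{u}}

theorem preservesBinaryJoins_of_orderIso (e : B.obj.carrier ≃o C.obj.carrier) :
    PreservesBinaryJoins e := fun x y j h => by
  rw [isBinaryJoin_iff] at h ⊢
  rw [h, e.map_sup]

theorem nonempty_iso (f : PCBHom B.obj.carrier C.obj.carrier)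
    (g : PCBHom C.obj.carrier B.obj.carrier) (hgf : Function.LeftInverse g.toFun f.toFun)
    (hfg : Function.RightInverse g.toFun f.toFun) : Nonempty (B ≅ C) := by
  let e : B.obj.carrier ≃o C.obj.carrier := Equiv.toOrderIso ⟨f.toFun, g.toFun, hgf, hfg⟩
    (fun _ _ => f.map_le) (fun _ _ => g.map_le)
  exact ⟨⟨f, preservesBinaryJoins_of_orderIso e⟩, ⟨g, preservesBinaryJoins_of_orderIso e.symm⟩,
    Subtype.ext (PCBHom.ext (funext hgf)), Subtype.ext (PCBHom.ext (funext hfg))⟩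

variable (B)

/-- The complete orthomodular lattice of a transitive joined piecewise complete Boolean algebra. -/
noncomputable def toCOML : COML.{u} := ⟨B.obj.carrier⟩

/-- The identity of the carrier, as a morphism from the piecewise complete Boolean algebra of the
lattice of `B`. -/
def homOfToCOML : PCBHom B.toCOML.toTJPCBoolean.obj.carrier B.obj.carrier where
  toFun x := x
  map_comm _ _ := (comm_iff_commutes (B := B)).2
  map_neg _ := rfl
  map_sup X hX := by
    let Y : Set B.obj.carrier := X
    have hY {Z : Set B.obj.carrier} (h : Z = Y) (hZ : PairwiseRel PCBData.comm Z) :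
        sSup Y = PCBData.sup Z hZ := by rw [sup_eq_sSup, h]
    exact hY (Set.image_id Y) _

/-- The identity of the carrier, as a morphism into the piecewise complete Boolean algebra of the
lattice of `B`. -/
def homToToCOML : PCBHom B.obj.carrier B.toCOML.toTJPCBoolean.obj.carrier where
  toFun x := x
  map_comm _ _ := (comm_iff_commutes (B := B)).1
  map_neg _ := rfl
  map_sup X hX := (sup_eq_sSup hX).trans (congrArg sSup (Set.image_id X).symm)

end TJPCBoolean

instance : comlToTJPCBoolean.{u}.EssSurj where
  mem_essImage B :=
    ⟨B.toCOML, TJPCBoolean.nonempty_iso B.homOfToCOML B.homToToCOML (fun _ => rfl) fun _ => rfl⟩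

/-! # Stone spaces of Boolean algebras -/

/-- The Stone space of a Boolean algebra: its two-valued homomorphisms, with the topology of
pointwise convergence. -/
def StoneSpace (B : Type u) [BooleanAlgebra B] : Type u := BoundedLatticeHom B Bool

namespace StoneSpace

section BooleanAlgebra

variable {B C : Type u} [BooleanAlgebra B] [BooleanAlgebra C]

instance : FunLike (StoneSpace B) B Bool := inferInstanceAs (FunLike (BoundedLatticeHom B Bool) _ _)

instance : BoundedLatticeHomClass (StoneSpace B) B Bool :=
  inferInstanceAs (BoundedLatticeHomClass (BoundedLatticeHom B Bool) _ _)

instance : TopologicalSpace (StoneSpace B) := .induced DFunLike.coe inferInstance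

theorem isEmbedding_coe : Topology.IsEmbedding (DFunLike.coe : StoneSpace B → B → Bool) :=
  ⟨⟨rfl⟩, DFunLike.coe_injective⟩

theorem continuous_apply (p : B) : Continuous fun x : StoneSpace B => x p :=
  (_root_.continuous_apply p).comp isEmbedding_coe.continuous

instance : T2Space (StoneSpace B) := isEmbedding_coe.t2Space

theorem isClosed_range_coe :
    IsClosed (Set.range (DFunLike.coe : StoneSpace B → B → Bool)) := by
  have h : Set.range (DFunLike.coe : StoneSpace B → B → Bool) =
      {x | (∀ p q, x (p ⊔ q) = x p ⊔ x q) ∧ (∀ p q, x (p ⊓ q) = x p ⊓ x q) ∧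
        x ⊤ = ⊤ ∧ x ⊥ = ⊥} := by
    ext x
    refine ⟨?_, fun ⟨hsup, hinf, htop, hbot⟩ => ⟨(⟨⟨⟨x, hsup⟩, hinf⟩, htop, hbot⟩ :
      BoundedLatticeHom B Bool), rfl⟩⟩
    rintro ⟨x, rfl⟩
    exact ⟨map_sup x, map_inf x, map_top x, map_bot x⟩
  rw [h]
  simp only [Set.ofPred_and, Set.ofPred_forall]
  have hsup : Continuous fun b : Bool × Bool => b.1 ⊔ b.2 := continuous_of_discreteTopology
  have hinf : Continuous fun b : Bool × Bool => b.1 ⊓ b.2 := continuous_of_discreteTopology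
  refine .inter (isClosed_iInter fun p => isClosed_iInter fun q => isClosed_eq (by fun_prop) ?_)
    (.inter (isClosed_iInter fun p => isClosed_iInter fun q => isClosed_eq (by fun_prop) ?_)
      (.inter (isClosed_eq (by fun_prop) (by fun_prop)) (isClosed_eq (by fun_prop) (by fun_prop))))
  · exact hsup.comp (by fun_prop : Continuous fun x : B → Bool => (x p, x q))
  · exact hinf.comp (by fun_prop : Continuous fun x : B → Bool => (x p, x q))

instance : CompactSpace (StoneSpace B) :=
  (Topology.IsClosedEmbedding.mk isEmbedding_coe isClosed_range_coe).compactSpace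

/-- The clopen set of an element of a Boolean algebra. -/
def basicOpen (p : B) : Set (StoneSpace B) := {x | x p = true}

theorem mem_basicOpen {p : B} {x : StoneSpace B} : x ∈ basicOpen p ↔ x p = true := Iff.rfl

theorem isClopen_basicOpen (p : B) : IsClopen (basicOpen p) :=
  (isClopen_discrete {true}).preimage (continuous_apply p)

theorem basicOpen_compl (p : B) : basicOpen pᶜ = (basicOpen p)ᶜ := by
  ext x
  simp [mem_basicOpen]

/-- The Boolean prime ideal theorem. -/
theorem exists_mem_basicOpen_of_not_le {p q : B} (h : ¬ p ≤ q) :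
    ∃ x ∈ basicOpen p, x ∉ basicOpen q := by
  classical
  obtain ⟨J, hJ, hqJ, hpJ⟩ := DistribLattice.prime_ideal_of_disjoint_filter_ideal
    (F := .principal p) (I := .principal q)
    (Set.disjoint_left.2 fun r (hpr : p ≤ r) (hrq : r ≤ q) => h (hpr.trans hrq))
  have hinf (r s : B) : r ⊓ s ∈ J ↔ r ∈ J ∨ s ∈ J :=
    ⟨hJ.mem_or_mem, fun h => h.elim (J.lower inf_le_left) (J.lower inf_le_right)⟩
  let x : BoundedLatticeHom B Bool :=
    { toFun r := !decide (r ∈ J)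
      map_sup' r s := by simp [Order.Ideal.sup_mem_iff]
      map_inf' r s := by simp [hinf]
      map_top' := by simp [hJ.toIsProper.top_notMem]
      map_bot' := by simp }
  have hx (r : B) : x r = true ↔ r ∉ J := by simp [x, ← BoundedLatticeHom.toFun_eq_coe]
  exact ⟨x, (hx p).2 (Set.disjoint_left.1 hpJ (le_refl p)), fun hq => (hx q).1 hq (hqJ (le_refl q))⟩

theorem basicOpen_subset_basicOpen {p q : B} : basicOpen p ⊆ basicOpen q ↔ p ≤ q := by
  refine ⟨fun h => ?_, fun h x hx => ?_⟩
  · by_contra hpq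
    obtain ⟨x, hp, hq⟩ := exists_mem_basicOpen_of_not_le hpq
    exact hq (h hp)
  · exact top_le_iff.1 ((mem_basicOpen.1 hx).ge.trans (OrderHomClass.mono x h))

theorem isTopologicalBasis_range_basicOpen :
    TopologicalSpace.IsTopologicalBasis (Set.range (basicOpen (B := B))) := by
  refine TopologicalSpace.isTopologicalBasis_of_isOpen_of_nhds ?_ ?_
  · rintro _ ⟨p, rfl⟩
    exact (isClopen_basicOpen p).isOpen
  · rintro x _ hx ⟨V, hV, rfl⟩
    obtain ⟨I, v, hv, hvV⟩ := isOpen_pi_iff.1 hV x hx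
    let p : B := I.inf fun i => if x i then i else iᶜ
    have hp (y : StoneSpace B) : y ∈ basicOpen p ↔ ∀ i ∈ I, y i = x i := by
      have hi (i : B) : y (if x i then i else iᶜ) = true ↔ y i = x i := by
        cases hxi : x i <;> simp
      rw [mem_basicOpen, map_finset_inf]
      simp only [← hi]
      exact Finset.inf_eq_top_iff _ _
    refine ⟨_, ⟨p, rfl⟩, (hp x).2 fun _ _ => rfl, fun y hy => hvV fun i hiI => ?_⟩
    rw [(hp y).1 hy i hiI]
    exact (hv i hiI).2

/-- The map of Stone spaces induced by a homomorphism of Boolean algebras. -/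
noncomputable def comap (f : BoundedLatticeHom B C) : C(StoneSpace C, StoneSpace B) where
  toFun x := BoundedLatticeHom.comp x f
  continuous_toFun :=
    isEmbedding_coe.continuous_iff.2 (continuous_pi fun p => continuous_apply (f p))

theorem comap_mem_basicOpen {f : BoundedLatticeHom B C} {x : StoneSpace C} {p : B} :
    comap f x ∈ basicOpen p ↔ x ∈ basicOpen (f p) := Iff.rfl

/-- The image is closed, and it meets each nonempty basic open set. -/
theorem comap_surjective {f : BoundedLatticeHom B C} (hf : Function.Injective f) :
    Function.Surjective (comap f) := by
  have hdense : DenseRange (comap f) := by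
    refine isTopologicalBasis_range_basicOpen.dense_iff.2 ?_
    rintro _ ⟨p, rfl⟩ ⟨y, hy⟩
    have hp : ¬ f p ≤ ⊥ := fun h => by
      rw [le_bot_iff, ← map_bot f, hf.eq_iff] at h
      simp [h, mem_basicOpen] at hy
    obtain ⟨x, hx, -⟩ := exists_mem_basicOpen_of_not_le hp
    exact ⟨comap f x, hx, x, rfl⟩
  exact Set.range_eq_univ.1 ((isCompact_range (comap f).continuous).isClosed.closure_eq.symm.trans
    hdense.closure_range)

end BooleanAlgebra

variable {B C : Type u} [CompleteBooleanAlgebra B] [CompleteBooleanAlgebra C]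

/-- The element of a complete Boolean algebra whose clopen set is the closure of the open set
`U`. -/
def clopenHull (U : Set (StoneSpace B)) : B := sSup {p | basicOpen p ⊆ U}

theorem basicOpen_clopenHull {U : Set (StoneSpace B)} (hU : IsOpen U) :
    basicOpen (clopenHull U) = closure U := by
  refine subset_antisymm (fun x hx => ?_) (closure_minimal (fun x hx => ?_)
    (isClopen_basicOpen _).isClosed)
  · refine isTopologicalBasis_range_basicOpen.mem_closure_iff.2 ?_
    rintro _ ⟨q, rfl⟩ hxq
    refine Set.not_disjoint_iff_nonempty_inter.1 fun hqU => ?_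
    have hq : clopenHull U ≤ qᶜ := sSup_le fun p hp => by
      rw [← basicOpen_subset_basicOpen, basicOpen_compl, Set.subset_compl_iff_disjoint_left]
      exact hqU.mono_right hp
    exact (basicOpen_compl q ▸ basicOpen_subset_basicOpen.2 hq) hx hxq
  · obtain ⟨_, ⟨p, rfl⟩, hxp, hpU⟩ :=
      isTopologicalBasis_range_basicOpen.exists_subset_of_mem_open hx hU
    exact basicOpen_subset_basicOpen.2 (le_sSup hpU) hxp

theorem clopenHull_le {U : Set (StoneSpace B)} {p : B} (h : U ⊆ basicOpen p) : clopenHull U ≤ p :=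
  sSup_le fun _ hq => basicOpen_subset_basicOpen.1 (hq.trans h)

theorem clopenHull_preimage_comap (f : CompleteLatticeHom B C) {U : Set (StoneSpace B)}
    (hU : IsOpen U) : clopenHull (comap (f : BoundedLatticeHom B C) ⁻¹' U) = f (clopenHull U) := by
  refine le_antisymm (clopenHull_le fun x hx => ?_) ?_
  · exact (basicOpen_clopenHull hU ▸ subset_closure) hx
  · rw [clopenHull, map_sSup]
    refine sSup_le ?_
    rintro _ ⟨p, hp, rfl⟩
    exact le_sSup fun x hx => hp hx

/-! # Spectral families of continuous functions on Stone spaces -/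

/-- The spectral family of a continuous function, indexed by balls in the plane. -/
def spec (a : C(StoneSpace B, ℂ)) (z : ℂ) (ε : ℝ) : B := clopenHull (a ⁻¹' Metric.ball z ε)

variable {a : C(StoneSpace B, ℂ)} {z : ℂ} {ε : ℝ} {x : StoneSpace B}

theorem basicOpen_spec : basicOpen (spec a z ε) = closure (a ⁻¹' Metric.ball z ε) :=
  basicOpen_clopenHull (Metric.isOpen_ball.preimage a.continuous)

theorem mem_basicOpen_spec (h : dist (a x) z < ε) : x ∈ basicOpen (spec a z ε) :=
  basicOpen_spec.ge (subset_closure h)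

theorem dist_le_of_mem_basicOpen_spec (h : x ∈ basicOpen (spec a z ε)) : dist (a x) z ≤ ε :=
  closure_minimal (t := a ⁻¹' Metric.closedBall z ε)
    (Set.preimage_mono Metric.ball_subset_closedBall)
    (Metric.isClosed_closedBall.preimage a.continuous) (basicOpen_spec.le h)

theorem apply_eq_of_spec {b : C(StoneSpace C, ℂ)} {y : StoneSpace C}
    (h : ∀ z ε, x ∈ basicOpen (spec a z ε) → y ∈ basicOpen (spec b z ε)) : a x = b y := by
  by_contra hne
  have hpos : 0 < dist (a x) (b y) := dist_pos.2 hne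
  have hx : x ∈ basicOpen (spec a (a x) (dist (a x) (b y) / 2)) :=
    mem_basicOpen_spec (by rw [dist_self]; positivity)
  have hy := dist_le_of_mem_basicOpen_spec (h _ _ hx)
  rw [dist_comm] at hy
  linarith

theorem spec_injective : Function.Injective (spec : C(StoneSpace B, ℂ) → ℂ → ℝ → B) :=
  fun _ _ h => ContinuousMap.ext fun _ => apply_eq_of_spec fun _ _ hx => h ▸ hx

theorem spec_comp_comap (f : CompleteLatticeHom B C) (a : C(StoneSpace B, ℂ)) (z : ℂ) (ε : ℝ) :
    spec (a.comp (comap (f : BoundedLatticeHom B C))) z ε = f (spec a z ε) :=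
  clopenHull_preimage_comap f (Metric.isOpen_ball.preimage a.continuous)

/-- A continuous function on the Stone space of `C` with spectral family in `B` is constant on the
fibres of the quotient map to the Stone space of `B`. -/
theorem exists_comp_comap {f : BoundedLatticeHom B C} (hf : Function.Injective f)
    {b : C(StoneSpace C, ℂ)} (hb : ∀ z ε, spec b z ε ∈ Set.range f) :
    ∃ a : C(StoneSpace B, ℂ), a.comp (comap f) = b := by
  have hquot : Topology.IsQuotientMap (comap f) :=
    (comap f).continuous.isClosedMap.isQuotientMap (comap f).continuous (comap_surjective hf)
  refine ⟨hquot.lift b fun x y hxy => apply_eq_of_spec fun z ε hx => ?_, hquot.lift_comp _ _⟩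
  obtain ⟨p, hp⟩ := hb z ε
  rw [← hp, ← comap_mem_basicOpen] at hx ⊢
  rwa [← hxy]

end StoneSpace

/-! # Projections in the continuous functions on a Stone space -/

namespace StoneSpace

section BooleanAlgebra

variable {B C : Type u} [BooleanAlgebra B] [BooleanAlgebra C] {p : B} {x : StoneSpace B}

/-- The characteristic function of the clopen set of an element of a Boolean algebra. -/
noncomputable def indicator (p : B) : C(StoneSpace B, ℂ) where
  toFun := (basicOpen p).indicator 1
  continuous_toFun := continuous_one.indicator (by simp [(isClopen_basicOpen p).frontier_eq])

theorem indicator_apply_of_mem (h : x ∈ basicOpen p) : indicator p x = 1 :=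
  Set.indicator_of_mem h 1

theorem indicator_apply_of_notMem (h : x ∉ basicOpen p) : indicator p x = 0 :=
  Set.indicator_of_notMem h 1

theorem isStarProjection_indicator (p : B) : IsStarProjection (indicator p) := by
  constructor <;> ext x <;> by_cases h : x ∈ basicOpen p <;>
    simp [indicator_apply_of_mem, indicator_apply_of_notMem, h]

theorem indicator_comp_comap (f : BoundedLatticeHom B C) (p : B) :
    (indicator p).comp (comap f) = indicator (f p) := rfl

theorem mul_indicator_eq_self_iff {a : C(StoneSpace B, ℂ)} :
    a * indicator p = a ↔ ∀ x, a x ≠ 0 → x ∈ basicOpen p := by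
  constructor
  · intro h x hx
    by_contra hp
    refine hx ?_
    rw [← h, ContinuousMap.mul_apply, indicator_apply_of_notMem hp, mul_zero]
  · intro h
    ext x
    by_cases hx : a x = 0
    · simp [hx]
    · simp [indicator_apply_of_mem (h x hx)]

theorem indicator_mul_indicator_eq_left_iff {p q : B} :
    indicator p * indicator q = indicator p ↔ p ≤ q := by
  rw [mul_indicator_eq_self_iff, ← basicOpen_subset_basicOpen]
  refine ⟨fun h x hx => h x ?_, fun h x hx => h ?_⟩
  · simp [indicator_apply_of_mem hx]
  · by_contra hp
    exact hx (indicator_apply_of_notMem hp)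

theorem indicator_compl (p : B) : indicator pᶜ = 1 - indicator p := by
  ext x
  by_cases h : x ∈ basicOpen p
  · have hc : x ∉ basicOpen pᶜ := by rwa [basicOpen_compl, Set.notMem_compl_iff]
    simp [indicator_apply_of_mem h, indicator_apply_of_notMem hc]
  · have hc : x ∈ basicOpen pᶜ := by rwa [basicOpen_compl]
    simp [indicator_apply_of_notMem h, indicator_apply_of_mem hc]

end BooleanAlgebra

variable {B : Type u} [CompleteBooleanAlgebra B]

theorem spec_indicator (p : B) : spec (indicator p) 1 (1 / 2) = p := by
  have h : indicator p ⁻¹' Metric.ball (1 : ℂ) (1 / 2) = basicOpen p := by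
    ext x
    by_cases hx : x ∈ basicOpen p
    · simp [hx, indicator_apply_of_mem hx]
    · simp only [Set.mem_preimage, indicator_apply_of_notMem hx, hx, Metric.mem_ball]
      norm_num
  refine le_antisymm ?_ ?_ <;> rw [← basicOpen_subset_basicOpen, basicOpen_spec, h]
  · exact (isClopen_basicOpen p).isClosed.closure_eq.le
  · exact subset_closure

theorem eq_indicator_of_isStarProjection {a : C(StoneSpace B, ℂ)} (ha : IsStarProjection a) :
    a = indicator (spec a 1 (1 / 2)) := by
  ext x
  have hx : IsIdempotentElem (a x) := DFunLike.congr_fun ha.isIdempotentElem x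
  rcases IsIdempotentElem.iff_eq_zero_or_one.1 hx with h | h
  · have hspec : x ∉ basicOpen (spec a 1 (1 / 2)) := fun hspec => by
      have := dist_le_of_mem_basicOpen_spec hspec
      rw [h] at this
      norm_num at this
    rw [h, indicator_apply_of_notMem hspec]
  · rw [h, indicator_apply_of_mem (mem_basicOpen_spec (by rw [h, dist_self]; norm_num))]

/-- For the support `U` of `S`, the annihilator of `S` is generated by the characteristic function
of the complement of the closure of `U`. -/
theorem isAWStarAlgebra : IsAWStarAlgebra C(StoneSpace B, ℂ) := by
  intro S
  let U : Set (StoneSpace B) := ⋃ a ∈ S, {x | a x ≠ 0}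
  have hU : IsOpen U :=
    isOpen_biUnion fun a _ => isOpen_ne_fun a.continuous continuous_const
  refine ⟨indicator (clopenHull U)ᶜ, isStarProjection_indicator _, subset_antisymm ?_ ?_⟩
  · intro b hb
    refine ⟨b, ?_⟩
    rw [mul_comm, eq_comm, mul_indicator_eq_self_iff]
    intro x hx
    rw [basicOpen_compl, basicOpen_clopenHull hU]
    have hdisj : Disjoint {x | b x ≠ 0} U := by
      refine Set.disjoint_iUnion₂_right.2 fun a ha => Set.disjoint_left.2 fun y hby hay => ?_
      exact mul_ne_zero hay hby (DFunLike.congr_fun (hb a ha) y)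
    exact Set.disjoint_left.1 (hdisj.closure_right
      (isOpen_ne_fun b.continuous continuous_const)) hx
  · rintro _ ⟨b, rfl⟩ a ha
    have h : a * indicator (clopenHull U) = a := mul_indicator_eq_self_iff.2 fun x hx => by
      rw [basicOpen_clopenHull hU]
      exact subset_closure (Set.mem_biUnion ha hx)
    rw [indicator_compl, ← mul_assoc, mul_sub, mul_one, h, sub_self, zero_mul]

end StoneSpace

/-! # Commutative AW*-algebras -/

namespace StoneSpace

theorem eq_top_of_indicator_mem {B : Type u} [BooleanAlgebra B]
    {S : StarSubalgebra ℂ C(StoneSpace B, ℂ)} (hS : IsClosed (S : Set C(StoneSpace B, ℂ)))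
    (h : ∀ p, indicator p ∈ S) : S = ⊤ := by
  have hsep : S.SeparatesPoints := by
    intro x y hxy
    obtain ⟨p, hp⟩ := DFunLike.ne_iff.1 hxy
    refine ⟨_, ⟨indicator p, h p, rfl⟩, ?_⟩
    cases hx : x p <;> cases hy : y p <;>
      simp_all [indicator_apply_of_mem, indicator_apply_of_notMem, mem_basicOpen]
  rw [← ContinuousMap.starSubalgebra_topologicalClosure_eq_top_of_separatesPoints S hsep]
  exact SetLike.coe_injective hS.closure_eq.symm

end StoneSpace

/-- The idempotents of a commutative ring, which form a Boolean algebra. For a commutative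
C*-algebra they are the projections. -/
abbrev IdempotentElem (R : Type u) [Mul R] : Type u := {p : R // IsIdempotentElem p}

namespace IdempotentElem

variable {R : Type u} [CommRing R] (p q : IdempotentElem R)

theorem coe_sup : ((p ⊔ q : IdempotentElem R) : R) = p + q - p * q := rfl

theorem coe_inf : ((p ⊓ q : IdempotentElem R) : R) = p * q := rfl

theorem coe_top : ((⊤ : IdempotentElem R) : R) = 1 := rfl

theorem coe_bot : ((⊥ : IdempotentElem R) : R) = 0 := rfl

end IdempotentElem

namespace GelfandDual

open WeakDual

variable {C : Type u} [CommCStarAlgebra C]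

theorem ext_apply {a b : C} (h : ∀ x : characterSpace ℂ C, x a = x b) : a = b :=
  (gelfandTransform_isometry C).injective (ContinuousMap.ext h)

theorem exists_forall_apply_eq (g : C(characterSpace ℂ C, ℂ)) :
    ∃ a : C, ∀ x : characterSpace ℂ C, x a = g x := by
  obtain ⟨a, rfl⟩ := (gelfandStarTransform C).surjective g
  exact ⟨a, fun _ => rfl⟩

theorem continuous_apply (a : C) : Continuous fun x : characterSpace ℂ C => x a :=
  (gelfandTransform ℂ C a).continuous

theorem apply_eq_zero_or_one (x : characterSpace ℂ C) {p : C} (hp : IsIdempotentElem p) :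
    x p = 0 ∨ x p = 1 :=
  IsIdempotentElem.iff_eq_zero_or_one.1 (hp.map x)

theorem isStarProjection_of_isIdempotentElem {p : C} (hp : IsIdempotentElem p) :
    IsStarProjection p where
  isIdempotentElem := hp
  isSelfAdjoint := ext_apply fun x => by
    rcases apply_eq_zero_or_one x hp with h | h <;> simp [map_star, h]

theorem exists_apply_ne_zero_of_isOpen {x : characterSpace ℂ C} {U : Set (characterSpace ℂ C)}
    (hU : IsOpen U) (hx : x ∈ U) : ∃ a : C, x a ≠ 0 ∧ ∀ y ∉ U, y a = 0 := by
  obtain ⟨g, hgU, hgx, -⟩ := exists_continuous_zero_one_of_isClosed hU.isClosed_compl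
    (isClosed_singleton (x := x)) (by simpa using hx)
  obtain ⟨a, ha⟩ := exists_forall_apply_eq (C := C)
    ⟨fun y => (g y : ℂ), Complex.continuous_ofReal.comp g.continuous⟩
  exact ⟨a, by simp [ha, hgx rfl], fun y hy => by simp [ha, hgU hy]⟩

/-- The restriction of a character to the idempotents, where its values are `0` and `1`. -/
noncomputable def restrictIdempotents (x : characterSpace ℂ C) : StoneSpace (IdempotentElem C) :=
  show BoundedLatticeHom (IdempotentElem C) Bool from
  { toFun p := decide (x p.1 = 1)
    map_sup' p q := by
      rcases apply_eq_zero_or_one x p.2 with hp | hp <;>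
        rcases apply_eq_zero_or_one x q.2 with hq | hq <;> simp [IdempotentElem.coe_sup, hp, hq]
    map_inf' p q := by
      rcases apply_eq_zero_or_one x p.2 with hp | hp <;>
        rcases apply_eq_zero_or_one x q.2 with hq | hq <;> simp [IdempotentElem.coe_inf, hp, hq]
    map_top' := by simp [IdempotentElem.coe_top]
    map_bot' := by simp [IdempotentElem.coe_bot] }

theorem restrictIdempotents_mem_basicOpen {x : characterSpace ℂ C} {p : IdempotentElem C} :
    restrictIdempotents x ∈ StoneSpace.basicOpen p ↔ x p.1 = 1 :=
  decide_eq_true_iff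

theorem continuous_restrictIdempotents :
    Continuous (restrictIdempotents (C := C)) := by
  refine StoneSpace.isTopologicalBasis_range_basicOpen.continuous_iff.2 ?_
  rintro _ ⟨p, rfl⟩
  have h : restrictIdempotents ⁻¹' StoneSpace.basicOpen p =
      {x : characterSpace ℂ C | x p.1 ≠ 0} := by
    ext x
    rw [Set.mem_preimage, restrictIdempotents_mem_basicOpen]
    rcases apply_eq_zero_or_one x p.2 with hp | hp <;> simp [hp]
  rw [h]
  exact isOpen_ne_fun (continuous_apply p.1) continuous_const

theorem restrictIdempotents_surjective :
    Function.Surjective (restrictIdempotents (C := C)) := by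
  have hdense : DenseRange (restrictIdempotents (C := C)) := by
    refine StoneSpace.isTopologicalBasis_range_basicOpen.dense_iff.2 ?_
    rintro _ ⟨p, rfl⟩ ⟨y, hy⟩
    have hp : (p : C) ≠ 0 := by
      rintro hp
      obtain rfl : p = ⊥ := Subtype.ext hp
      simp [StoneSpace.mem_basicOpen] at hy
    obtain ⟨x, hx⟩ : ∃ x : characterSpace ℂ C, x p.1 ≠ 0 := by
      by_contra! h
      exact hp (ext_apply fun x => by rw [h, map_zero])
    exact ⟨_, restrictIdempotents_mem_basicOpen.2 ((apply_eq_zero_or_one x p.2).resolve_left hx),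
      x, rfl⟩
  rw [← Set.range_eq_univ, ← hdense.closure_range]
  exact (isCompact_range continuous_restrictIdempotents).isClosed.closure_eq.symm

end GelfandDual

namespace IsAWStarAlgebra

open WeakDual GelfandDual
open scoped CStarAlgebra

variable {C D : Type u} [CommCStarAlgebra C] [CommCStarAlgebra D]

/-- If `a` and `b` are nonzero at `x` and `y` and have disjoint supports, then the annihilator
of `a` is generated by a projection that is `0` at `x` and `1` at `y`. -/
theorem restrictIdempotents_injective (hC : IsAWStarAlgebra C) :
    Function.Injective (restrictIdempotents (C := C)) := by
  intro x y hxy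
  by_contra hne
  obtain ⟨U, V, hU, hV, hxU, hyV, hUV⟩ := t2_separation hne
  obtain ⟨a, hxa, ha⟩ := exists_apply_ne_zero_of_isOpen hU hxU
  obtain ⟨b, hyb, hb⟩ := exists_apply_ne_zero_of_isOpen hV hyV
  have hab : a * b = 0 := ext_apply fun z => by
    rw [map_mul, map_zero, mul_eq_zero, or_iff_not_imp_left]
    exact fun hz => hb z (Set.disjoint_left.1 hUV (not_imp_comm.1 (ha z) hz))
  obtain ⟨p, hp, hann⟩ := hC {a}
  simp only [Set.mem_singleton_iff, forall_eq] at hann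
  have hap : a * p = 0 := hann.ge ⟨1, (mul_one p).symm⟩
  obtain ⟨c, rfl⟩ : ∃ c, b = p * c := hann.le hab
  have hx : x p ≠ 1 := fun h => hxa (by simpa [h] using congrArg x hap)
  have hy : y p ≠ 0 := fun h => hyb (by rw [map_mul, h, zero_mul])
  let q : IdempotentElem C := ⟨p, hp.isIdempotentElem⟩
  refine hx (restrictIdempotents_mem_basicOpen (p := q).1 ?_)
  rw [hxy]
  exact restrictIdempotents_mem_basicOpen.2 ((apply_eq_zero_or_one y q.2).resolve_left hy)

/-- The Gelfand dual of a commutative AW*-algebra is the Stone space of its projections. -/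
noncomputable def dualHomeomorph (hC : IsAWStarAlgebra C) :
    characterSpace ℂ C ≃ₜ StoneSpace (IdempotentElem C) :=
  continuous_restrictIdempotents.homeoOfEquivCompactToT2
    (f := .ofBijective _ ⟨hC.restrictIdempotents_injective, restrictIdempotents_surjective⟩)

/-- A commutative AW*-algebra is the algebra of continuous functions on the Stone space of its
projections. -/
noncomputable def equivStoneSpace (hC : IsAWStarAlgebra C) :
    C ≃⋆ₐ[ℂ] C(StoneSpace (IdempotentElem C), ℂ) :=
  (gelfandStarTransform C).trans (hC.dualHomeomorph.symm.compStarAlgEquiv' ℂ ℂ)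

theorem equivStoneSpace_restrictIdempotents (hC : IsAWStarAlgebra C) (a : C)
    (x : characterSpace ℂ C) : hC.equivStoneSpace a (restrictIdempotents x) = x a :=
  congrArg (gelfandStarTransform C a) (hC.dualHomeomorph.symm_apply_apply x)

theorem equivStoneSpace_idempotent (hC : IsAWStarAlgebra C) (p : IdempotentElem C) :
    hC.equivStoneSpace p = StoneSpace.indicator p := by
  ext x
  obtain ⟨x, rfl⟩ := restrictIdempotents_surjective x
  rw [equivStoneSpace_restrictIdempotents]
  rcases apply_eq_zero_or_one x p.2 with h | h
  · rw [h, StoneSpace.indicator_apply_of_notMem]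
    simp [restrictIdempotents_mem_basicOpen, h]
  · rw [h, StoneSpace.indicator_apply_of_mem (restrictIdempotents_mem_basicOpen.2 h)]

theorem eq_top_of_idempotents_mem (hC : IsAWStarAlgebra C) {S : StarSubalgebra ℂ C}
    (hS : IsClosed (S : Set C)) (h : ∀ p : IdempotentElem C, (p : C) ∈ S) : S = ⊤ := by
  let e := hC.equivStoneSpace
  have hcomap : S.comap e.symm.toStarAlgHom = ⊤ := by
    refine StoneSpace.eq_top_of_indicator_mem
      (hS.preimage (map_continuous e.symm.toStarAlgHom)) fun p => ?_
    rw [StarSubalgebra.mem_comap, ← hC.equivStoneSpace_idempotent]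
    exact (e.symm_apply_apply p.1).symm ▸ h p
  refine eq_top_iff.2 fun a _ => ?_
  have ha : e a ∈ S.comap e.symm.toStarAlgHom := hcomap ▸ StarSubalgebra.mem_top
  exact e.symm_apply_apply a ▸ ha

theorem map_mem_of_idempotents (hC : IsAWStarAlgebra C) (φ : C →⋆ₐ[ℂ] D)
    {S : StarSubalgebra ℂ D} (hS : IsClosed (S : Set D))
    (h : ∀ p : IdempotentElem C, φ p ∈ S) (a : C) : φ a ∈ S := by
  have hcomap : S.comap φ = ⊤ :=
    hC.eq_top_of_idempotents_mem (hS.preimage (map_continuous φ)) h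
  exact (hcomap ▸ StarSubalgebra.mem_top : a ∈ S.comap φ)

theorem starAlgHom_ext (hC : IsAWStarAlgebra C) {φ ψ : C →⋆ₐ[ℂ] D}
    (h : ∀ p : IdempotentElem C, φ p = ψ p) : φ = ψ := by
  have heq : StarAlgHom.equalizer φ ψ = ⊤ := hC.eq_top_of_idempotents_mem
    (isClosed_eq (map_continuous φ) (map_continuous ψ)) h
  ext a
  exact (heq ▸ StarSubalgebra.mem_top : a ∈ StarAlgHom.equalizer φ ψ)

theorem exists_starAlgHom (hC : IsAWStarAlgebra C) (hD : IsAWStarAlgebra D)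
    (f : BoundedLatticeHom (IdempotentElem C) (IdempotentElem D)) :
    ∃ φ : C →⋆ₐ[ℂ] D, ∀ p : IdempotentElem C, φ p = f p := by
  refine ⟨hD.equivStoneSpace.symm.toStarAlgHom.comp
    (((StoneSpace.comap f).compStarAlgHom' ℂ ℂ).comp hC.equivStoneSpace.toStarAlgHom),
    fun p => hD.equivStoneSpace.symm_apply_eq.2 ?_⟩
  rw [equivStoneSpace_idempotent, ← StoneSpace.indicator_comp_comap]
  exact congrArg (ContinuousMap.comp · _) (hC.equivStoneSpace_idempotent p)

end IsAWStarAlgebra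

/-! # Projections of commeasurable AW*-subalgebras -/

/-- The complete Boolean algebra structure on a Boolean algebra all of whose subsets have
suprema. -/
noncomputable abbrev completeBooleanAlgebraOfExistsIsLUB {L : Type u} [BooleanAlgebra L]
    (h : ∀ X : Set L, ∃ s, IsLUB X s) : CompleteBooleanAlgebra L :=
  { ‹BooleanAlgebra L› with
    sSup := fun X => (h X).choose
    sInf := fun X => (h (lowerBounds X)).choose
    isLUB_sSup := fun X => (h X).choose_spec
    isGLB_sInf := fun X => isLUB_lowerBounds.1 (h (lowerBounds X)).choose_spec }

/-- The commeasurable subalgebra on the range of an injective function from a complete Boolean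
algebra that preserves complements and suprema. -/
noncomputable def CommeasurableSubalgebra.range {L B : Type u} [CompleteBooleanAlgebra L]
    [PCBData B] (v : L → B) (hv : Function.Injective v)
    (hcomm : PairwiseRel PCBData.comm (Set.range v))
    (hcompl : ∀ x, v xᶜ = PCBData.neg (v x))
    (hsSup : ∀ (X : Set L) (hX : PairwiseRel PCBData.comm (v '' X)),
      v (sSup X) = PCBData.sup (v '' X) hX) :
    CommeasurableSubalgebra (Set.range v) where
  pairwise_comm := hcomm
  alg := (Equiv.ofInjective v hv).symm.completeBooleanAlgebra
  coe_compl x := by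
    obtain ⟨a, rfl⟩ := (Equiv.ofInjective v hv).surjective x
    refine (congrArg v (congrArg compl ?_)).trans (hcompl a)
    exact Equiv.symm_apply_apply _ _
  coe_sSup X hX := by
    obtain ⟨Y, rfl⟩ := (Equiv.ofInjective v hv).surjective.image_surjective X
    have hY : Subtype.val '' (Equiv.ofInjective v hv '' Y) = v '' Y := Set.image_image _ _ _
    have hsup : ⨆ a ∈ Equiv.ofInjective v hv '' Y, (Equiv.ofInjective v hv).symm a = sSup Y := by
      rw [iSup_image, sSup_eq_iSup]
      simp only [Equiv.symm_apply_apply]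
    refine (congrArg v hsup).trans ((hsSup Y (hY ▸ hX)).trans ?_)
    exact PCBData.sup_congr hY.symm _ _

/-- A function between Boolean algebras that preserves complements and binary suprema, as a
homomorphism of bounded lattices. -/
def boundedLatticeHomOfSupCompl {L L' : Type u} [BooleanAlgebra L] [BooleanAlgebra L']
    (f : L → L') (hsup : ∀ x y, f (x ⊔ y) = f x ⊔ f y) (hcompl : ∀ x, f xᶜ = (f x)ᶜ) :
    BoundedLatticeHom L L' :=
  have htop : f ⊤ = ⊤ := by rw [← sup_compl_eq_top (x := ⊥), hsup, hcompl, sup_compl_eq_top]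
  { toFun := f
    map_sup' := hsup
    map_inf' x y := compl_injective (by rw [← hcompl, compl_inf, hsup, hcompl, hcompl, compl_inf])
    map_top' := htop
    map_bot' := by rw [← compl_top, hcompl, htop, compl_top] }

namespace CommeasurableAWStarSubalgebra

variable {A : Type u} [PAWStarData A] {T : Set A} (M : CommeasurableAWStarSubalgebra T)

/-- The C*-algebra given by a commeasurable AW*-subalgebra `M` on `T`. It is a synonym of `T`
that remembers `M`, so that the operations are found as an instance. -/
def Elem (_ : CommeasurableAWStarSubalgebra T) : Type u := T

noncomputable instance : CommCStarAlgebra M.Elem := M.alg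

/-- The inclusion of a commeasurable AW*-subalgebra. -/
def val (x : M.Elem) : A := Subtype.val (p := (· ∈ T)) x

theorem val_mem (x : M.Elem) : M.val x ∈ T := Subtype.prop (p := (· ∈ T)) x

theorem exists_val_eq {x : A} (hx : x ∈ T) : ∃ a : M.Elem, M.val a = x := ⟨⟨x, hx⟩, rfl⟩

theorem isAWStarAlgebra : IsAWStarAlgebra M.Elem := M.isAWStar

variable {M}

theorem val_injective : Function.Injective M.val := Subtype.val_injective

theorem comm_val (x y : M.Elem) : PCStarData.comm (M.val x) (M.val y) :=
  M.pairwise_comm _ (M.val_mem x) _ (M.val_mem y)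

theorem val_one : M.val 1 = PCStarData.one := M.coe_one

theorem val_star (x : M.Elem) : M.val (star x) = PCStarData.star (M.val x) := M.coe_star x

theorem val_smul (z : ℂ) (x : M.Elem) : M.val (z • x) = PCStarData.smul z (M.val x) :=
  M.coe_smul z x

theorem norm_val (x : M.Elem) : PCStarData.norm (M.val x) = ‖x‖ := (M.coe_norm x).symm

theorem val_add (x y : M.Elem) :
    M.val (x + y) = PCStarData.add (M.val x) (M.val y) (comm_val x y) := M.coe_add x y _

theorem val_mul (x y : M.Elem) :
    M.val (x * y) = PCStarData.mul (M.val x) (M.val y) (comm_val x y) := M.coe_mul x y _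

variable (M) in
/-- The idempotents of a commeasurable AW*-subalgebra, as projections of the piecewise
algebra. -/
def toPProj (p : IdempotentElem M.Elem) : PProj A :=
  ⟨M.val p, by
    rw [← val_star, (GelfandDual.isStarProjection_of_isIdempotentElem p.2).isSelfAdjoint], by
    rw [← val_mul, p.2]⟩

variable (M) in
theorem exists_toPProj_eq {p : PProj A} (hp : p.1 ∈ T) : ∃ a, M.toPProj a = p := by
  obtain ⟨a, ha⟩ := M.exists_val_eq hp
  refine ⟨⟨a, val_injective ?_⟩, Subtype.ext ha⟩
  simp only [val_mul, ha]
  exact p.2.2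

theorem toPProj_injective : Function.Injective M.toPProj := fun _ _ h =>
  Subtype.ext (val_injective (M := M) (congrArg (fun x : PProj A => x.1) h))

theorem comm_toPProj (p q : IdempotentElem M.Elem) :
    PCBData.comm (M.toPProj p) (M.toPProj q) := comm_val (M := M) p q

variable (M) in
theorem pairwiseRel_range_toPProj : PairwiseRel PCBData.comm (Set.range M.toPProj) := by
  rintro _ ⟨p, rfl⟩ _ ⟨q, rfl⟩
  exact comm_toPProj p q

theorem pairwiseRel_image_toPProj (X : Set (IdempotentElem M.Elem)) :
    PairwiseRel PCBData.comm (M.toPProj '' X) :=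
  M.pairwiseRel_range_toPProj.mono (Set.image_subset_range _ _)

theorem toPProj_compl (p : IdempotentElem M.Elem) : M.toPProj pᶜ = PCBData.neg (M.toPProj p) :=
  Subtype.ext (M.coe_oneSub _)

theorem exists_isLUB (X : Set (IdempotentElem M.Elem)) :
    ∃ s, IsLUB X s ∧ M.toPProj s = PCBData.sup _ (pairwiseRel_image_toPProj X) := by
  obtain ⟨s, hs, hsproj, hub, hlub⟩ := M.sup_spec (M.toPProj '' X) (pairwiseRel_image_toPProj X)
    (by rintro _ ⟨p, -, rfl⟩; exact M.val_mem _)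
  refine ⟨⟨s, IsStarProjection.isIdempotentElem (R := M.Elem) hsproj⟩,
    ⟨fun p hp => ?_, fun q hq => ?_⟩, Subtype.ext hs⟩
  · exact (hub p.1 ⟨_, ⟨p, hp, rfl⟩, rfl⟩).symm
  · refine (hlub q.1 (GelfandDual.isStarProjection_of_isIdempotentElem (C := M.Elem) q.2) ?_).symm
    rintro p ⟨_, ⟨x, hx, rfl⟩, hxp⟩
    obtain rfl : x.1 = p := val_injective (M := M) hxp
    exact (hq hx).symm

theorem toPProj_of_isLUB {X : Set (IdempotentElem M.Elem)} {s : IdempotentElem M.Elem}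
    (hs : IsLUB X s) : M.toPProj s = PCBData.sup _ (pairwiseRel_image_toPProj X) := by
  obtain ⟨t, ht, h⟩ := exists_isLUB X
  rw [hs.unique ht, h]

theorem toPProj_sup (p q : IdempotentElem M.Elem) :
    M.toPProj (p ⊔ q) =
      PCBData.sup {M.toPProj p, M.toPProj q} (PCBData.pairwiseRel_pair (comm_toPProj p q)) :=
  (toPProj_of_isLUB isLUB_pair).trans (PCBData.sup_congr (Set.image_pair _ _ _) _ _)

variable (M) in
/-- The projections of a commeasurable AW*-subalgebra form a commeasurable subalgebra of the
projections of the piecewise algebra. -/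
noncomputable def projSubalgebra : CommeasurableSubalgebra (Set.range M.toPProj) :=
  letI : CompleteBooleanAlgebra (IdempotentElem M.Elem) :=
    completeBooleanAlgebraOfExistsIsLUB fun X => (exists_isLUB X).imp fun _ h => h.1
  .range M.toPProj toPProj_injective M.pairwiseRel_range_toPProj toPProj_compl
    fun X _ => toPProj_of_isLUB (isLUB_sSup X)

end CommeasurableAWStarSubalgebra

namespace PiecewiseAWStarAlgebra

variable {A : Type u} [PiecewiseAWStarAlgebra A] {S S' : Set A}

/-- The carrier of the coherently chosen commeasurable AW*-subalgebra containing `S`. -/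
def hullCarrier (S : Set A) (hS : PairwiseRel PCStarData.comm S) : Set A :=
  (exists_subalgebra_mono (A := A)).choose S hS

/-- The coherently chosen commeasurable AW*-subalgebra containing `S`. -/
noncomputable def hull (S : Set A) (hS : PairwiseRel PCStarData.comm S) :
    CommeasurableAWStarSubalgebra (hullCarrier S hS) :=
  ((exists_subalgebra_mono (A := A)).choose_spec.2.1 S hS).some

theorem subset_hullCarrier (hS : PairwiseRel PCStarData.comm S) : S ⊆ hullCarrier S hS :=
  (exists_subalgebra_mono (A := A)).choose_spec.1 S hS

theorem hullCarrier_mono (hS : PairwiseRel PCStarData.comm S)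
    (hS' : PairwiseRel PCStarData.comm S') (h : S ⊆ S') : hullCarrier S hS ⊆ hullCarrier S' hS' :=
  (exists_subalgebra_mono (A := A)).choose_spec.2.2 S hS S' hS' h

theorem exists_val_eq (a : A) :
    ∃ (T : Set A) (M : CommeasurableAWStarSubalgebra T) (x : M.Elem), M.val x = a := by
  have ha := pairwiseRel_singleton (PCStarData.comm_refl a)
  exact ⟨_, hull {a} ha, (hull {a} ha).exists_val_eq (subset_hullCarrier ha rfl)⟩

theorem exists_val_eq_of_comm {a b : A} (h : PCStarData.comm a b) :
    ∃ (T : Set A) (M : CommeasurableAWStarSubalgebra T) (x y : M.Elem),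
      M.val x = a ∧ M.val y = b := by
  have hab := pairwiseRel_pair PCStarData.comm_refl PCStarData.comm_symm h
  exact ⟨_, hull {a, b} hab, ⟨a, subset_hullCarrier hab (by simp)⟩,
    ⟨b, subset_hullCarrier hab (by simp)⟩, rfl, rfl⟩

end PiecewiseAWStarAlgebra

theorem PProj.pairwiseRel_image_val {A : Type u} [PAWStarData A] {X : Set (PProj A)}
    (hX : PairwiseRel PCBData.comm X) : PairwiseRel PCStarData.comm (Subtype.val '' X) :=
  hX.image (f := Subtype.val) fun _ _ h => h

instance {A : Type u} [PiecewiseAWStarAlgebra A] : PiecewiseCBA (PProj A) where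
  exists_subalgebra S hS := by
    have hS' := PProj.pairwiseRel_image_val hS
    exact ⟨_, fun p hp => (PiecewiseAWStarAlgebra.hull _ hS').exists_toPProj_eq
      (PiecewiseAWStarAlgebra.subset_hullCarrier hS' ⟨p, hp, rfl⟩),
      ⟨CommeasurableAWStarSubalgebra.projSubalgebra _⟩⟩

/-! # Morphisms of piecewise AW*-algebras -/

namespace CommeasurableAWStarSubalgebra

section

variable {A B : Type u} [PAWStarData A] [PAWStarData B] {T U : Set A} {V : Set B}
  (M : CommeasurableAWStarSubalgebra T)

/-- A function between commeasurable AW*-subalgebras that is given by a morphism, as a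
homomorphism of C*-algebras. -/
noncomputable def starAlgHomOfVal {N : CommeasurableAWStarSubalgebra V} (f : PCStarHom A B)
    (g : M.Elem → N.Elem) (hg : ∀ x, N.val (g x) = f.toFun (M.val x)) : M.Elem →⋆ₐ[ℂ] N.Elem :=
  { AlgHom.ofLinearMap
      { toFun := g
        map_add' := fun x y => val_injective (by simp only [hg, val_add, f.map_add])
        map_smul' := fun z x => val_injective (by
          simp only [hg, val_smul, f.map_smul, RingHom.id_apply]) }
      (val_injective (by
        simp only [LinearMap.coe_mk, AddHom.coe_mk, hg, val_one, f.map_one]))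
      (fun x y => val_injective (by
        simp only [LinearMap.coe_mk, AddHom.coe_mk, hg, val_mul, f.map_mul])) with
    map_star' := fun x => val_injective (by
      simp [hg, val_star, f.map_star]) }

/-- The restriction of a morphism to commeasurable AW*-subalgebras. -/
noncomputable def restrict (f : PCStarHom A B) (N : CommeasurableAWStarSubalgebra V)
    (h : Set.MapsTo f.toFun T V) : M.Elem →⋆ₐ[ℂ] N.Elem :=
  M.starAlgHomOfVal f (fun x => show V from ⟨f.toFun (M.val x), h (M.val_mem x)⟩) fun _ => rfl

/-- The inclusion of a commeasurable AW*-subalgebra in a larger one. -/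
noncomputable def inclusion (N : CommeasurableAWStarSubalgebra U) (h : T ⊆ U) :
    M.Elem →⋆ₐ[ℂ] N.Elem :=
  M.restrict (PCStarHom.id A) N h

theorem val_inclusion (N : CommeasurableAWStarSubalgebra U) (h : T ⊆ U) (x : M.Elem) :
    N.val (M.inclusion N h x) = M.val x := rfl

theorem isClosed_range_inclusion (N : CommeasurableAWStarSubalgebra U) (h : T ⊆ U) :
    IsClosed ((M.inclusion N h).range : Set N.Elem) := by
  have hisometry : Isometry (M.inclusion N h) := AddMonoidHomClass.isometry_of_norm _ fun x => by
    rw [← norm_val, val_inclusion, norm_val]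
  change IsClosed (Set.range (M.inclusion N h))
  exact hisometry.isClosedEmbedding.isClosed_range

/-- The image in `B` of the projections of `M` under a function on projections. -/
def projImage (φ : PProj A → PProj B) : Set B := Set.range fun p => (φ (M.toPProj p)).1

theorem mem_projImage (φ : PProj A → PProj B) (p : IdempotentElem M.Elem) :
    (φ (M.toPProj p)).1 ∈ M.projImage φ := ⟨p, rfl⟩

theorem pairwiseRel_projImage {φ : PProj A → PProj B}
    (hφ : ∀ p q, PCBData.comm p q → PCBData.comm (φ p) (φ q)) :
    PairwiseRel PCStarData.comm (M.projImage φ) := by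
  rintro _ ⟨p, rfl⟩ _ ⟨q, rfl⟩
  exact hφ _ _ (comm_toPProj p q)

theorem projImage_mono (N : CommeasurableAWStarSubalgebra U) (h : T ⊆ U)
    (φ : PProj A → PProj B) : M.projImage φ ⊆ N.projImage φ := by
  rintro _ ⟨p, rfl⟩
  obtain ⟨q, hq⟩ := N.exists_toPProj_eq (p := M.toPProj p) (h (M.val_mem p))
  exact ⟨q, congrArg (fun x => (φ x).1) hq⟩

theorem exists_boundedLatticeHom (f : PCBHom (PProj A) (PProj B))
    (N : CommeasurableAWStarSubalgebra V) (h : M.projImage f.toFun ⊆ V) :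
    ∃ g : BoundedLatticeHom (IdempotentElem M.Elem) (IdempotentElem N.Elem),
      ∀ p, N.toPProj (g p) = f.toFun (M.toPProj p) := by
  choose g hg using fun p => N.exists_toPProj_eq (h (M.mem_projImage f.toFun p))
  refine ⟨boundedLatticeHomOfSupCompl g (fun p q => toPProj_injective ?_)
    fun p => toPProj_injective ?_, hg⟩
  · rw [hg, toPProj_sup, f.map_sup, toPProj_sup]
    exact PCBData.sup_congr (by rw [Set.image_pair, hg, hg]) _ _
  · rw [hg, toPProj_compl, f.map_neg, toPProj_compl, hg]

end

section

open PiecewiseAWStarAlgebra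

variable {A B : Type u} [PAWStarData A] [PiecewiseAWStarAlgebra B] {T U : Set A}
  (M : CommeasurableAWStarSubalgebra T)

/-- By density of the span of the projections, and since the coherent choice of subalgebras
exhibits the smaller one as a closed subset of the one generated by the whole image. -/
theorem mapsTo_hullCarrier (f : PCStarHom A B) {φ : PProj A → PProj B}
    (hφ : PairwiseRel PCStarData.comm (M.projImage φ)) (h : ∀ p, f.onProj p = φ p) :
    Set.MapsTo f.toFun T (hullCarrier (M.projImage φ) hφ) := by
  have hT := M.pairwise_comm.image f.map_comm
  have hle : hullCarrier (M.projImage φ) hφ ⊆ hullCarrier (f.toFun '' T) hT := by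
    refine hullCarrier_mono hφ hT ?_
    rintro _ ⟨p, rfl⟩
    exact ⟨_, M.val_mem p, congrArg (fun x : PProj B => x.1) (h (M.toPProj p))⟩
  have hmaps : Set.MapsTo f.toFun T (hullCarrier (f.toFun '' T) hT) := fun x hx =>
    subset_hullCarrier hT ⟨x, hx, rfl⟩
  intro x hx
  obtain ⟨a, rfl⟩ := M.exists_val_eq hx
  obtain ⟨b, hb⟩ := M.isAWStarAlgebra.map_mem_of_idempotents (M.restrict f (hull _ hT) hmaps)
    ((hull _ hφ).isClosed_range_inclusion (hull _ hT) hle) (fun p => by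
      obtain ⟨b, hb⟩ := (hull _ hφ).exists_val_eq
        (subset_hullCarrier hφ (M.mem_projImage φ p))
      refine ⟨b, val_injective (hb.trans ?_)⟩
      exact congrArg (fun x : PProj B => x.1) (h (M.toPProj p)).symm) a
  have hab : (hull _ hφ).val b = f.toFun (M.val a) := congrArg (hull _ hT).val hb
  exact hab ▸ (hull _ hφ).val_mem b

theorem exists_extension (f : PCBHom (PProj A) (PProj B)) :
    ∃ φ : M.Elem →⋆ₐ[ℂ] (hull _ (M.pairwiseRel_projImage f.map_comm)).Elem,
      ∀ p : IdempotentElem M.Elem, (hull _ _).val (φ p) = (f.toFun (M.toPProj p)).1 := by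
  let N := hull _ (M.pairwiseRel_projImage f.map_comm)
  obtain ⟨g, hg⟩ := M.exists_boundedLatticeHom f N (subset_hullCarrier _)
  obtain ⟨φ, hφ⟩ := M.isAWStarAlgebra.exists_starAlgHom N.isAWStarAlgebra g
  exact ⟨φ, fun p => (congrArg N.val (hφ p)).trans (congrArg (fun x : PProj B => x.1) (hg p))⟩

/-- The extension of a morphism of projections to a commeasurable AW*-subalgebra. -/
noncomputable def extension (f : PCBHom (PProj A) (PProj B)) :
    M.Elem →⋆ₐ[ℂ] (hull _ (M.pairwiseRel_projImage f.map_comm)).Elem :=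
  (M.exists_extension f).choose

theorem val_extension_idempotent (f : PCBHom (PProj A) (PProj B)) (p : IdempotentElem M.Elem) :
    (hull _ _).val (M.extension f p) = (f.toFun (M.toPProj p)).1 :=
  (M.exists_extension f).choose_spec p

theorem val_extension_inclusion (f : PCBHom (PProj A) (PProj B))
    (N : CommeasurableAWStarSubalgebra U) (h : T ⊆ U) (x : M.Elem) :
    (hull _ _).val (N.extension f (M.inclusion N h x)) = (hull _ _).val (M.extension f x) := by
  have hle := hullCarrier_mono (M.pairwiseRel_projImage f.map_comm)
    (N.pairwiseRel_projImage f.map_comm) (M.projImage_mono N h _)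
  have hext : (N.extension f).comp (M.inclusion N h) =
      ((hull _ _).inclusion (hull _ _) hle).comp (M.extension f) :=
    M.isAWStarAlgebra.starAlgHom_ext fun p => val_injective
      ((N.val_extension_idempotent f ⟨_, p.2.map (M.inclusion N h)⟩).trans
        (M.val_extension_idempotent f p).symm)
  exact congrArg (hull _ _).val (DFunLike.congr_fun hext x)

end

end CommeasurableAWStarSubalgebra

namespace PCStarHom

open CommeasurableAWStarSubalgebra PiecewiseAWStarAlgebra

theorem ext_onProj {A B : Type u} [PiecewiseAWStarAlgebra A] [PiecewiseAWStarAlgebra B]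
    {f g : PCStarHom A B} (h : ∀ p, f.onProj p = g.onProj p) : f = g := by
  refine PCStarHom.ext (funext fun a => ?_)
  obtain ⟨T, M, x, rfl⟩ := exists_val_eq a
  have hφ := M.pairwiseRel_projImage g.onProj_comm
  have hext : M.restrict f (hull _ hφ) (M.mapsTo_hullCarrier f hφ h) =
      M.restrict g (hull _ hφ) (M.mapsTo_hullCarrier g hφ fun _ => rfl) :=
    M.isAWStarAlgebra.starAlgHom_ext fun p => val_injective
      (congrArg (fun x : PProj B => x.1) (h (M.toPProj p)))
  exact congrArg (hull _ hφ).val (DFunLike.congr_fun hext x)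

theorem onProj_neg {A B : Type u} [PiecewiseCStarAlgebra A] [PiecewiseCStarAlgebra B]
    (f : PCStarHom A B) (p : PProj A) : f.onProj p.neg = (f.onProj p).neg :=
  Subtype.ext (by
    simp only [PProj.neg, onProj, PiecewiseCStarAlgebra.oneSub, f.map_add, f.map_one, f.map_smul])

end PCStarHom

namespace PCBHom

open CommeasurableAWStarSubalgebra PiecewiseAWStarAlgebra

variable {A B : Type u} [PiecewiseAWStarAlgebra A] [PiecewiseAWStarAlgebra B]
  (f : PCBHom (PProj A) (PProj B))

/-- The extension of a morphism of projections to a piecewise AW*-algebra, as a function. -/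
noncomputable def extendFun (a : A) : B :=
  have ha := pairwiseRel_singleton (PCStarData.comm_refl a)
  (hull _ _).val ((hull {a} ha).extension f
    (show hullCarrier {a} ha from ⟨a, subset_hullCarrier ha rfl⟩))

theorem extendFun_val {T : Set A} (M : CommeasurableAWStarSubalgebra T) (x : M.Elem) :
    f.extendFun (M.val x) = (hull _ _).val (M.extension f x) := by
  have hx := pairwiseRel_singleton (PCStarData.comm_refl (M.val x))
  let N := hull T M.pairwise_comm
  have hMN := subset_hullCarrier M.pairwise_comm
  have hle := hullCarrier_mono hx M.pairwise_comm (Set.singleton_subset_iff.2 (M.val_mem x))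
  rw [← M.val_extension_inclusion f N hMN]
  exact (val_extension_inclusion (hull _ hx) f N hle _).symm

theorem comm_extendFun {a b : A} (h : PCStarData.comm a b) :
    PCStarData.comm (f.extendFun a) (f.extendFun b) := by
  obtain ⟨T, M, x, y, rfl, rfl⟩ := exists_val_eq_of_comm h
  rw [extendFun_val, extendFun_val]
  exact comm_val _ _

/-- The extension of a morphism of projections to a piecewise AW*-algebra. -/
noncomputable def extend : PCStarHom A B where
  toFun := f.extendFun
  map_comm _ _ := f.comm_extendFun
  map_one := by
    obtain ⟨T, M, -, -⟩ := exists_val_eq (PCStarData.one : A)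
    rw [← val_one (M := M), extendFun_val, map_one, val_one]
  map_mul a b h := by
    obtain ⟨T, M, x, y, rfl, rfl⟩ := exists_val_eq_of_comm h
    simp only [← val_mul, extendFun_val, map_mul]
  map_add a b h := by
    obtain ⟨T, M, x, y, rfl, rfl⟩ := exists_val_eq_of_comm h
    simp only [← val_add, extendFun_val, map_add]
  map_smul z a := by
    obtain ⟨T, M, x, rfl⟩ := exists_val_eq a
    rw [← val_smul, extendFun_val, extendFun_val, map_smul, val_smul]
  map_star a := by
    obtain ⟨T, M, x, rfl⟩ := exists_val_eq a
    rw [← val_star, extendFun_val, extendFun_val, map_star, val_star]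

theorem extend_onProj (p : PProj A) : f.extend.onProj p = f.toFun p := by
  obtain ⟨T, M, x, hx⟩ := exists_val_eq p.1
  obtain ⟨p, rfl⟩ := M.exists_toPProj_eq (hx ▸ M.val_mem x)
  exact Subtype.ext ((f.extendFun_val M p).trans (M.val_extension_idempotent f p))

end PCBHom

/-- The projections of a transitive joined piecewise AW*-algebra. -/
@[reducible] def TJPAWStar.proj (A : TJPAWStar.{u}) : TJPCBoolean.{u} where
  obj := ⟨PProj A.obj.carrier⟩
  transitive := A.transitive
  joined := A.joined

/-- The functor sending a transitive joined piecewise AW*-algebra to its projections. -/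
def projFunctor : TJPAWStar.{u} ⥤ TJPCBoolean.{u} where
  obj A := A.proj
  map f :=
    ⟨{ toFun := (PAWStarHom.toPCStarHom f.1).onProj
       map_comm := (PAWStarHom.toPCStarHom f.1).onProj_comm
       map_neg := (PAWStarHom.toPCStarHom f.1).onProj_neg
       map_sup := PAWStarHom.map_sup f.1 }, f.2⟩

instance : projFunctor.{u}.Faithful where
  map_injective h := Subtype.ext (PAWStarHom.ext (congrArg PCStarHom.toFun
    (PCStarHom.ext_onProj fun p => congrFun (congrArg (fun k => PCBHom.toFun k.1) h) p)))

instance : projFunctor.{u}.Full where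
  map_surjective {A B} f := by
    let g : PCBHom (PProj A.obj.carrier) (PProj B.obj.carrier) := f.1
    have hg : g.extend.onProj = g.toFun := funext g.extend_onProj
    let φ : PAWStarHom A.obj.carrier B.obj.carrier :=
      { g.extend with
        map_sup X hX := (g.extend_onProj _).trans ((g.map_sup X hX).trans
          (PCBData.sup_congr (congrArg (· '' X) hg.symm) _ _)) }
    have hφ : PreservesBinaryJoins φ.onProj := hg ▸ f.2
    exact ⟨⟨φ, hφ⟩, Subtype.ext (PCBHom.ext hg)⟩

/-! # Commutative C*-algebras of observables -/

/-- The commutative C*-algebra structure transported along a bijection. -/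
noncomputable abbrev commCStarAlgebraOfEquiv {α β : Type u} [CommCStarAlgebra β] (e : α ≃ β) :
    CommCStarAlgebra α :=
  letI : CommRing α := e.commRing
  letI : NormedCommRing α := NormedCommRing.induced α β e.ringEquiv e.injective
  letI : Algebra ℂ α := e.algebra ℂ
  letI : NormedAlgebra ℂ α := NormedAlgebra.induced ℂ α β (e.algEquiv ℂ)
  have hmul (x y : α) : e (x * y) = e x * e y := e.apply_symm_apply _
  have hadd (x y : α) : e (x + y) = e x + e y := e.apply_symm_apply _
  have hsmul (z : ℂ) (x : α) : e (z • x) = z • e x := e.apply_symm_apply _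
  letI : Star α := ⟨fun a => e.symm (star (e a))⟩
  have hstar (x : α) : e (star x) = star (e x) := e.apply_symm_apply _
  letI : StarRing α :=
    { star_involutive := fun x => e.injective (by simp only [hstar, star_star])
      star_mul := fun x y => e.injective (by simp only [hstar, hmul, star_mul])
      star_add := fun x y => e.injective (by simp only [hstar, hadd, star_add]) }
  { star_smul := fun z x => e.injective (by simp only [hstar, hsmul, star_smul])
    norm_mul_self_le := fun x => by
      change ‖e x‖ * ‖e x‖ ≤ ‖e (star x * x)‖
      rw [hmul, hstar, CStarRing.norm_star_mul_self]
    toCompleteSpace := by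
      have h : Isometry e := AddMonoidHomClass.isometry_of_norm e.ringEquiv fun _ => rfl
      exact (h.isUniformInducing.completeSpace_congr e.surjective).2 inferInstance }

theorem IsAWStarAlgebra.of_starAlgEquiv {C D : Type u} [CStarAlgebra C] [CStarAlgebra D]
    (hD : IsAWStarAlgebra D) (e : C ≃⋆ₐ[ℂ] D) : IsAWStarAlgebra C := by
  intro S
  obtain ⟨p, hp, h⟩ := hD (e '' S)
  refine ⟨e.symm p, hp.map e.symm, Set.ext fun y => ?_⟩
  calc y ∈ {y | ∀ x ∈ S, x * y = 0}
    _ ↔ e y ∈ {y | ∀ x ∈ e '' S, x * y = 0} := by simp [← map_mul]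
    _ ↔ ∃ z, e y = p * z := by rw [h]; rfl
    _ ↔ ∃ z, y = e.symm p * z := (EquivLike.surjective e).exists.trans (exists_congr fun z => by
      rw [← (EquivLike.injective e).eq_iff (a := y), map_mul, e.apply_symm_apply])

namespace CompleteOrthomodularLattice

variable {P : Type u} [CompleteOrthomodularLattice P]

namespace CommutingSubalgebra

variable {R R' : CommutingSubalgebra P}

/-- The inclusion of a commuting subalgebra in a larger one. -/
def inclusion (h : R ≤ R') : CompleteLatticeHom R R' where
  toFun p := ⟨p, h p.2⟩
  map_sInf' X := Subtype.ext (congrArg sInf (Set.image_image Subtype.val (Set.inclusion h) X).symm)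
  map_sSup' X := Subtype.ext (congrArg sSup (Set.image_image Subtype.val (Set.inclusion h) X).symm)

theorem inclusion_injective (h : R ≤ R') : Function.Injective (inclusion h) :=
  Set.inclusion_injective h

/-- The map of Stone spaces restricting homomorphisms to a smaller commuting subalgebra. -/
noncomputable def restrict (h : R ≤ R') : C(StoneSpace R', StoneSpace R) :=
  StoneSpace.comap (inclusion h : BoundedLatticeHom R R')

theorem restrict_surjective (h : R ≤ R') : Function.Surjective (restrict h) :=
  StoneSpace.comap_surjective (inclusion_injective h)

end CommutingSubalgebra

open StoneSpace CommutingSubalgebra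

variable (P) in
/-- The bounded complex observables of a complete orthomodular lattice: the spectral families of
the continuous functions on the Stone spaces of its commuting subalgebras. The same family may
come from many subalgebras. -/
def Observable : Type u :=
  {E : ℂ → ℝ → P // ∃ (R : CommutingSubalgebra P) (a : C(StoneSpace R, ℂ)),
    (fun z ε => ((spec a z ε : R) : P)) = E}

namespace Observable

/-- The elements occurring in the spectral family. -/
def values (E : Observable P) : Set P := {p | ∃ z ε, E.1 z ε = p}

/-- Observables are commeasurable when their spectral families commute. -/
def Comm (E F : Observable P) : Prop := ∀ p ∈ E.values, ∀ q ∈ F.values, Commutes p q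

theorem comm_self (E : Observable P) : Comm E E := by
  obtain ⟨_, R, a, rfl⟩ := E
  rintro _ ⟨z, ε, rfl⟩ _ ⟨w, δ, rfl⟩
  exact R.commutes _ (spec a z ε).2 _ (spec a w δ).2

theorem Comm.symm {E F : Observable P} (h : Comm E F) : Comm F E :=
  fun p hp q hq => (h q hq p hp).symm

theorem pairwiseRel_iUnion_values {S : Set (Observable P)} (hS : PairwiseRel Comm S) :
    PairwiseRel Commutes (⋃ E ∈ S, E.values) := by
  intro p hp q hq
  obtain ⟨E, hE, hp⟩ := Set.mem_iUnion₂.1 hp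
  obtain ⟨F, hF, hq⟩ := Set.mem_iUnion₂.1 hq
  exact hS E hE F hF p hp q hq

/-- The commuting subalgebra generated by pairwise commeasurable observables. -/
def span (S : Set (Observable P)) (hS : PairwiseRel Comm S) : CommutingSubalgebra P :=
  generate (⋃ E ∈ S, E.values) (pairwiseRel_iUnion_values hS)

theorem values_subset_span {S : Set (Observable P)} (hS : PairwiseRel Comm S) {E : Observable P}
    (hE : E ∈ S) : E.values ⊆ span S hS :=
  (Set.subset_biUnion_of_mem (u := values) hE).trans (subset_generate _)

theorem span_le {S : Set (Observable P)} {hS : PairwiseRel Comm S} {R : CommutingSubalgebra P} :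
    span S hS ≤ R ↔ ∀ E ∈ S, E.values ⊆ R :=
  generate_le.trans Set.iUnion₂_subset_iff

theorem span_mono {S S' : Set (Observable P)} {hS : PairwiseRel Comm S}
    {hS' : PairwiseRel Comm S'} (h : S ⊆ S') : span S hS ≤ span S' hS' :=
  span_le.2 fun _ hE => values_subset_span hS' (h hE)

section

variable (E : Observable P)

/-- The commuting subalgebra generated by an observable. -/
def spectrum : CommutingSubalgebra P := span {E} (pairwiseRel_singleton E.comm_self)

variable {E}

theorem values_subset_spectrum : E.values ⊆ E.spectrum := values_subset_span _ rfl

theorem spectrum_le {R : CommutingSubalgebra P} : E.spectrum ≤ R ↔ E.values ⊆ R :=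
  span_le.trans forall_eq

end

/-! # Observables as continuous functions -/

variable {R R' : CommutingSubalgebra P}

/-- The observable of a continuous function. -/
def ofFun (a : C(StoneSpace R, ℂ)) : Observable P := ⟨fun z ε => (spec a z ε : R), R, a, rfl⟩

theorem values_ofFun_subset (a : C(StoneSpace R, ℂ)) : (ofFun a).values ⊆ R := by
  rintro _ ⟨z, ε, rfl⟩
  exact (spec a z ε).2

theorem ofFun_injective : Function.Injective (ofFun : C(StoneSpace R, ℂ) → Observable P) :=
  fun _ _ h => spec_injective (funext₂ fun z ε =>
    Subtype.ext (congrFun₂ (congrArg Subtype.val h) z ε))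

theorem ofFun_comp_restrict (h : R ≤ R') (a : C(StoneSpace R, ℂ)) :
    ofFun (a.comp (restrict h)) = ofFun a :=
  Subtype.ext (funext₂ fun z ε => congrArg Subtype.val (spec_comp_comap (inclusion h) a z ε))

/-- The spectral family of an observable takes its values in the subalgebra it generates, so the
continuous function it comes from factors through the Stone space of that subalgebra. -/
theorem exists_ofFun_eq (E : Observable P) (h : E.values ⊆ R) :
    ∃ a : C(StoneSpace R, ℂ), ofFun a = E := by
  obtain ⟨R₀, b, hb⟩ : ∃ (R₀ : CommutingSubalgebra P) (b : C(StoneSpace R₀, ℂ)), ofFun b = E :=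
    E.2.imp fun _ => .imp fun _ => Subtype.ext
  have hR₀ : E.spectrum ≤ R₀ := spectrum_le.2 (hb ▸ values_ofFun_subset b)
  obtain ⟨a, ha⟩ : ∃ a : C(StoneSpace E.spectrum, ℂ), a.comp (restrict hR₀) = b :=
    exists_comp_comap (inclusion_injective hR₀) fun z ε =>
      ⟨⟨(spec b z ε : R₀), values_subset_spectrum (hb ▸ ⟨z, ε, rfl⟩)⟩, rfl⟩
  refine ⟨a.comp (restrict (spectrum_le.2 h)), ?_⟩
  rw [ofFun_comp_restrict, ← ofFun_comp_restrict hR₀, ha, hb]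

/-- The continuous function representing an observable on the Stone space of `R`. -/
noncomputable def rep (E : Observable P) (h : E.values ⊆ R) : C(StoneSpace R, ℂ) :=
  (E.exists_ofFun_eq h).choose

theorem ofFun_rep (E : Observable P) (h : E.values ⊆ R) : ofFun (E.rep h) = E :=
  (E.exists_ofFun_eq h).choose_spec

theorem spec_rep (E : Observable P) (h : E.values ⊆ R) (z : ℂ) (ε : ℝ) :
    ((spec (E.rep h) z ε : R) : P) = E.1 z ε :=
  congrFun₂ (congrArg Subtype.val (E.ofFun_rep h)) z ε

theorem rep_ofFun (a : C(StoneSpace R, ℂ)) (h : (ofFun a).values ⊆ R) : (ofFun a).rep h = a :=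
  ofFun_injective (ofFun_rep _ h)

theorem rep_comp_restrict (E : Observable P) (h : R ≤ R') (hE : E.values ⊆ R) :
    (E.rep hE).comp (restrict h) = E.rep (hE.trans h) :=
  ofFun_injective (by rw [ofFun_comp_restrict, ofFun_rep, ofFun_rep])

/-! # The piecewise C*-algebra of observables -/

/-- The result of a continuous binary operation on commeasurable observables. -/
noncomputable def combine (op : C(ℂ × ℂ, ℂ)) (E F : Observable P) (h : Comm E F) : Observable P :=
  have hEF : PairwiseRel Comm {E, F} := pairwiseRel_pair comm_self (fun _ _ => Comm.symm) h
  ofFun (op.comp (.prodMk (E.rep (values_subset_span hEF (.inl rfl)))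
    (F.rep (values_subset_span hEF (.inr rfl)))))

theorem combine_eq (op : C(ℂ × ℂ, ℂ)) {E F : Observable P} (h : Comm E F) (hE : E.values ⊆ R)
    (hF : F.values ⊆ R) : combine op E F h = ofFun (op.comp (.prodMk (E.rep hE) (F.rep hF))) := by
  have hEF : PairwiseRel Comm {E, F} := pairwiseRel_pair comm_self (fun _ _ => Comm.symm) h
  have hR : span {E, F} hEF ≤ R := span_le.2 (by rintro _ (rfl | rfl) <;> assumption)
  rw [← E.rep_comp_restrict hR (values_subset_span hEF (.inl rfl)),
    ← F.rep_comp_restrict hR (values_subset_span hEF (.inr rfl))]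
  exact (ofFun_comp_restrict hR _).symm

variable (P) in
/-- A constant observable. -/
noncomputable def const (z : ℂ) : Observable P :=
  ofFun (R := generate ∅ pairwiseRel_empty) (.const _ z)

theorem const_eq (z : ℂ) : const P z = ofFun (R := R) (.const _ z) :=
  (ofFun_comp_restrict (generate_le.2 (Set.empty_subset _)) _).symm

/-- The norm of an observable. -/
noncomputable def norm (E : Observable P) : ℝ := ‖E.rep values_subset_spectrum‖

theorem norm_rep (E : Observable P) (h : E.values ⊆ R) : ‖E.rep h‖ = E.norm := by
  rw [← E.rep_comp_restrict (spectrum_le.2 h) values_subset_spectrum, norm,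
    ContinuousMap.norm_eq_iSup_norm, ContinuousMap.norm_eq_iSup_norm]
  exact (restrict_surjective _).iSup_comp fun x => ‖E.rep values_subset_spectrum x‖

noncomputable instance : PCStarData (Observable P) where
  comm := Comm
  comm_refl := comm_self
  comm_symm _ _ h := h.symm
  zero := const P 0
  one := const P 1
  star E := combine ⟨fun z => star z.1, by fun_prop⟩ E E E.comm_self
  smul z E := combine ⟨fun w => z * w.1, by fun_prop⟩ E E E.comm_self
  norm := norm
  add E F h := combine ⟨fun z => z.1 + z.2, by fun_prop⟩ E F h
  mul E F h := combine ⟨fun z => z.1 * z.2, by fun_prop⟩ E F h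

variable (R) in
/-- The observables with spectral family in a commuting subalgebra. -/
def within : Set (Observable P) := {E | E.values ⊆ R}

/-- Observables with spectral family in `R` are continuous functions on the Stone space of `R`. -/
noncomputable def equiv : within R ≃ C(StoneSpace R, ℂ) where
  toFun E := E.1.rep E.2
  invFun a := ⟨ofFun a, values_ofFun_subset a⟩
  left_inv E := Subtype.ext (E.1.ofFun_rep E.2)
  right_inv a := rep_ofFun a _

noncomputable instance : CommCStarAlgebra (within R) := commCStarAlgebraOfEquiv equiv

/-- The bijection `equiv` as an isomorphism of C*-algebras. -/
noncomputable def starAlgEquiv : within R ≃⋆ₐ[ℂ] C(StoneSpace R, ℂ) :=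
  { equiv with
    map_mul' := fun _ _ => equiv.apply_symm_apply _
    map_add' := fun _ _ => equiv.apply_symm_apply _
    map_smul' := fun _ _ => equiv.apply_symm_apply _
    map_star' := fun _ => equiv.apply_symm_apply _ }

variable (R) in
/-- The commutative C*-algebra of observables with spectral family in a commuting subalgebra. -/
noncomputable def cstarSubalgebra : CommeasurableCStarSubalgebra (within R) where
  pairwise_comm _ hE _ hF p hp q hq := R.commutes p (hE hp) q (hF hq)
  alg := inferInstance
  coe_zero := (const_eq 0).symm
  coe_one := (const_eq 1).symm
  coe_star E := Eq.symm (combine_eq _ E.1.comm_self E.2 E.2)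
  coe_smul _ E := Eq.symm (combine_eq _ E.1.comm_self E.2 E.2)
  coe_norm E := E.1.norm_rep E.2
  coe_add E F h := Eq.symm (combine_eq _ h E.2 F.2)
  coe_mul E F h := Eq.symm (combine_eq _ h E.2 F.2)

noncomputable instance : PiecewiseCStarAlgebra (Observable P) where
  exists_subalgebra S hS :=
    ⟨_, fun _ hE => values_subset_span hS hE, ⟨cstarSubalgebra (span S hS)⟩⟩

end Observable

end CompleteOrthomodularLattice

namespace CompleteOrthomodularLattice

open StoneSpace CommutingSubalgebra

variable {P : Type u} [CompleteOrthomodularLattice P]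

namespace Observable

variable {R : CommutingSubalgebra P}

/-! # Projections -/

/-- The projection with given support. -/
noncomputable def projection (q : R) : within R := starAlgEquiv.symm (indicator q)

theorem isStarProjection_projection (q : R) : IsStarProjection (projection q) :=
  (isStarProjection_indicator q).map starAlgEquiv.symm

theorem isStarProjection_iff {p : within R} : IsStarProjection p ↔ ∃ q : R, p = projection q := by
  refine ⟨fun hp => ⟨spec (starAlgEquiv p) 1 (1 / 2), ?_⟩, ?_⟩
  · exact (starAlgEquiv.eq_symm_apply).2 (eq_indicator_of_isStarProjection (hp.map starAlgEquiv))
  · rintro ⟨q, rfl⟩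
    exact isStarProjection_projection q

theorem projection_eq_mul_iff {p q : R} : projection p = projection p * projection q ↔ p ≤ q := by
  rw [projection, projection, ← map_mul, (EquivLike.injective starAlgEquiv.symm).eq_iff, eq_comm,
    indicator_mul_indicator_eq_left_iff]

/-- The element of the lattice corresponding to a projection. -/
noncomputable def toElem (p : PProj (Observable P)) : P := p.1.1 1 (1 / 2)

theorem toElem_mem_values (p : PProj (Observable P)) : toElem p ∈ p.1.values := ⟨_, _, rfl⟩

theorem eq_projection (p : PProj (Observable P)) (h : p.1.values ⊆ R) :
    (⟨p.1, h⟩ : within R) = projection ⟨toElem p, h (toElem_mem_values p)⟩ := by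
  have hp : IsStarProjection (⟨p.1, h⟩ : within R) :=
    ⟨Subtype.ext (((cstarSubalgebra R).coe_mul ⟨p.1, h⟩ ⟨p.1, h⟩ _).trans p.2.2),
      Subtype.ext (((cstarSubalgebra R).coe_star ⟨p.1, h⟩).trans p.2.1)⟩
  refine starAlgEquiv.eq_symm_apply.2 ((eq_indicator_of_isStarProjection (hp.map _)).trans
    (congrArg indicator (Subtype.ext ?_)))
  exact p.1.spec_rep h 1 (1 / 2)

/-- The projection corresponding to an element of the lattice. -/
noncomputable def ofElem (q : P) : PProj (Observable P) :=
  let R := generate {q} (pairwiseRel_singleton (commutes_refl q))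
  let p : within R := projection ⟨q, subset_generate _ rfl⟩
  have hp : IsStarProjection p := isStarProjection_projection _
  ⟨p, ((cstarSubalgebra R).coe_star p).symm.trans (congrArg Subtype.val hp.isSelfAdjoint),
    ((cstarSubalgebra R).coe_mul p p _).symm.trans (congrArg Subtype.val hp.isIdempotentElem)⟩

theorem coe_projection (q : R) : (projection q : Observable P) = (ofElem (q : P)).1 := by
  have h : generate {(q : P)} (pairwiseRel_singleton (commutes_refl _)) ≤ R :=
    generate_le.2 (Set.singleton_subset_iff.2 q.2)
  exact ofFun_comp_restrict h (indicator ⟨q, subset_generate _ rfl⟩)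

theorem toElem_ofElem (q : P) : toElem (ofElem q) = q :=
  congrArg Subtype.val (spec_indicator _)

theorem ofElem_toElem (p : PProj (Observable P)) : ofElem (toElem p) = p := by
  have hp := eq_projection p values_subset_spectrum
  exact Subtype.ext ((coe_projection (R := p.1.spectrum) ⟨toElem p, _⟩).symm.trans
    (congrArg Subtype.val hp).symm)

theorem values_subset_iff {p : PProj (Observable P)} : p.1.values ⊆ R ↔ toElem p ∈ R := by
  refine ⟨fun h => h (toElem_mem_values p), fun h => ?_⟩
  rw [← ofElem_toElem p, ← coe_projection ⟨toElem p, h⟩]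
  exact Subtype.prop (projection _)

theorem comm_iff {p q : PProj (Observable P)} :
    PProj.comm p q ↔ Commutes (toElem p) (toElem q) := by
  refine ⟨fun h => h _ (toElem_mem_values p) _ (toElem_mem_values q), fun h => ?_⟩
  have hpq : PairwiseRel Commutes {toElem p, toElem q} :=
    pairwiseRel_pair commutes_refl (fun _ _ => Commutes.symm) h
  exact (cstarSubalgebra (generate _ hpq)).pairwise_comm
    _ (values_subset_iff.2 (subset_generate hpq (.inl rfl)))
    _ (values_subset_iff.2 (subset_generate hpq (.inr rfl)))

/-! # The piecewise AW*-algebra of observables -/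

/-- The support of an observable: where it does not vanish. -/
def support (E : Observable P) : P := sSup {p | ∃ z ε, ε < ‖z‖ ∧ E.1 z ε = p}

theorem support_mem {E : Observable P} (h : E.values ⊆ R) : E.support ∈ R :=
  R.sSup_mem (by rintro _ ⟨z, ε, _, rfl⟩; exact h ⟨z, ε, rfl⟩)

theorem support_le_iff {E : within R} {q : R} :
    E.1.support ≤ q ↔ ∀ x, equiv E x ≠ 0 → x ∈ basicOpen q := by
  have hspec (z : ℂ) (ε : ℝ) : ((spec (equiv E) z ε : R) : P) = E.1.1 z ε := E.1.spec_rep E.2 z ε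
  constructor
  · intro hle x hx
    have hpos : 0 < ‖equiv E x‖ := norm_pos_iff.2 hx
    have hspec_le : spec (equiv E) (equiv E x) (‖equiv E x‖ / 2) ≤ q :=
      (le_sSup ⟨_, _, half_lt_self hpos, (hspec _ _).symm⟩ : _ ≤ E.1.support).trans hle
    exact basicOpen_subset_basicOpen.2 hspec_le
      (mem_basicOpen_spec (by rw [dist_self]; exact half_pos hpos))
  · intro hx
    refine sSup_le ?_
    rintro _ ⟨z, ε, hz, rfl⟩
    rw [← hspec]
    refine basicOpen_subset_basicOpen.1 fun x hxz => hx x fun h0 => hz.not_ge ?_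
    simpa only [h0, dist_zero_left] using dist_le_of_mem_basicOpen_spec hxz

theorem mul_projection_eq_self_iff {E : within R} {q : R} :
    E * projection q = E ↔ E.1.support ≤ q := by
  rw [support_le_iff, ← mul_indicator_eq_self_iff, ← (EquivLike.injective starAlgEquiv).eq_iff,
    map_mul, projection, starAlgEquiv.apply_symm_apply]
  rfl

noncomputable instance : PAWStarData (Observable P) where
  rp E := ofElem E.support
  sup X _ := ofElem (sSup (toElem '' X))

theorem exists_support_projection (E : within R) :
    ∃ p : within R, (p : Observable P) = (PAWStarData.rp (E : Observable P)).1 ∧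
      IsStarProjection p ∧ E * p = E ∧ ∀ q, IsStarProjection q → E * q = E → p = p * q := by
  refine ⟨projection ⟨_, support_mem E.2⟩, coe_projection _, isStarProjection_projection _,
    mul_projection_eq_self_iff.2 le_rfl, fun q hq hE => ?_⟩
  obtain ⟨q, rfl⟩ := isStarProjection_iff.1 hq
  exact projection_eq_mul_iff.2 (mul_projection_eq_self_iff.1 hE)

theorem exists_sup_projection (X : Set (PProj (Observable P)))
    (hX : PairwiseRel PProj.comm X) (hXR : ∀ p ∈ X, p.1 ∈ within R) :
    ∃ s : within R, (s : Observable P) = (PAWStarData.sup X hX).1 ∧ IsStarProjection s ∧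
      (∀ p : within R, (∃ x ∈ X, x.1 = (p : Observable P)) → p = p * s) ∧
      ∀ q : within R, IsStarProjection q →
        (∀ p : within R, (∃ x ∈ X, x.1 = (p : Observable P)) → p = p * q) → s = s * q := by
  have hmem : sSup (toElem '' X) ∈ R :=
    R.sSup_mem (Set.image_subset_iff.2 fun x hx => values_subset_iff.1 (hXR x hx))
  refine ⟨projection ⟨_, hmem⟩, coe_projection _, isStarProjection_projection _, ?_,
    fun q hq hle => ?_⟩
  · rintro ⟨_, hx⟩ ⟨x, hxX, rfl⟩
    rw [eq_projection x hx]
    exact projection_eq_mul_iff.2 (le_sSup (Set.mem_image_of_mem _ hxX))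
  · obtain ⟨q, rfl⟩ := isStarProjection_iff.1 hq
    refine projection_eq_mul_iff.2 (sSup_le (Set.forall_mem_image.2 fun x hx => ?_))
    have hxq := hle ⟨x.1, hXR x hx⟩ ⟨x, hx, rfl⟩
    rw [eq_projection x (hXR x hx)] at hxq
    exact projection_eq_mul_iff.1 hxq

variable (R) in
/-- The commutative AW*-algebra of observables with spectral family in a commuting subalgebra. -/
noncomputable def awStarSubalgebra : CommeasurableAWStarSubalgebra (within R) where
  toCommeasurableCStarSubalgebra := cstarSubalgebra R
  isAWStar := StoneSpace.isAWStarAlgebra.of_starAlgEquiv starAlgEquiv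
  rp_spec := exists_support_projection
  sup_spec := exists_sup_projection

noncomputable instance : PiecewiseAWStarAlgebra (Observable P) where
  exists_subalgebra_mono :=
    ⟨fun S hS => within (span S hS), fun _ hS _ hE => values_subset_span hS hE,
      fun S hS => ⟨awStarSubalgebra (span S hS)⟩,
      fun _ _ _ _ h _ hE => Set.Subset.trans hE (span_mono h)⟩

theorem toElem_neg (p : PProj (Observable P)) : toElem p.neg = (toElem p)ᶜ := by
  let a : within p.1.spectrum := ⟨p.1, values_subset_spectrum⟩
  let q : p.1.spectrum := ⟨toElem p, values_subset_spectrum (toElem_mem_values p)⟩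
  have hq : a = projection q := eq_projection p values_subset_spectrum
  have ha : 1 - a = projection qᶜ := by
    rw [hq, projection, projection, indicator_compl, map_sub, map_one]
  have hneg : p.neg = ofElem (toElem p)ᶜ :=
    Subtype.ext (((cstarSubalgebra _).coe_oneSub a).symm.trans
      ((congrArg Subtype.val ha).trans (coe_projection qᶜ)))
  rw [hneg, toElem_ofElem]

section

attribute [local instance] toPiecewiseCBA

variable (P) in
/-- The projections of the algebra of observables are the elements of the lattice. -/
noncomputable def toElemHom : PCBHom (PProj (Observable P)) P where
  toFun := toElem
  map_comm _ _ := comm_iff.1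
  map_neg := toElem_neg
  map_sup _ _ := toElem_ofElem _

variable (P) in
/-- The inverse of `toElemHom`. -/
noncomputable def ofElemHom : PCBHom P (PProj (Observable P)) where
  toFun := ofElem
  map_comm p q h := comm_iff.2 (by rwa [toElem_ofElem, toElem_ofElem])
  map_neg p := by
    refine Function.LeftInverse.injective ofElem_toElem ?_
    rw [toElem_ofElem]
    exact ((toElem_neg _).trans (congrArg _ (toElem_ofElem p))).symm
  map_sup X hX := by
    refine Function.LeftInverse.injective ofElem_toElem ?_
    rw [toElem_ofElem]
    refine ((toElem_ofElem _).trans ?_).symm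
    rw [Function.LeftInverse.image_image toElem_ofElem]
    rfl

theorem inducedLE_iff_toElem_le {p q : PProj (Observable P)} :
    inducedLE p q ↔ toElem p ≤ toElem q := by
  rw [← inducedLE_iff]
  refine ⟨(toElemHom P).map_le, fun h => ?_⟩
  rw [← ofElem_toElem p, ← ofElem_toElem q]
  exact PCBHom.map_le (C := PProj (Observable P)) (ofElemHom P) h

end

variable (P) in
/-- The transitive joined piecewise AW*-algebra of a complete orthomodular lattice. -/
noncomputable def tjPAWStar : TJPAWStar.{u} where
  obj := ⟨Observable P⟩
  transitive _ _ _ := by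
    simpa only [inducedLE_iff_toElem_le] using le_trans (α := P)
  joined (p q : PProj (Observable P)) := by
    refine ⟨ofElem (toElem p ⊔ toElem q), ?_⟩
    simp only [IsBinaryJoin, inducedLE_iff_toElem_le, toElem_ofElem]
    exact ⟨le_sup_left, le_sup_right, fun _ => sup_le⟩

end Observable

end CompleteOrthomodularLattice

open CompleteOrthomodularLattice

instance : comlToTJPCBoolean.{u}.IsEquivalence where

instance : projFunctor.{u}.EssSurj where
  mem_essImage B := by
    obtain ⟨P, ⟨e⟩⟩ := Functor.EssSurj.mem_essImage (F := comlToTJPCBoolean) B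
    obtain ⟨e'⟩ : Nonempty ((Observable.tjPAWStar P.carrier).proj ≅ P.toTJPCBoolean) :=
      TJPCBoolean.nonempty_iso (Observable.toElemHom P.carrier :)
        (Observable.ofElemHom P.carrier :) (Observable.ofElem_toElem (P := P.carrier) ·)
        (Observable.toElem_ofElem (P := P.carrier) ·)
    exact ⟨_, ⟨e' ≪≫ e⟩⟩

instance : projFunctor.{u}.IsEquivalence where

theorem mainTheorem9 :
    Nonempty (COML.{u} ≌ TJPCBoolean.{u}) ∧
    Nonempty (TJPCBoolean.{u} ≌ TJPAWStar.{u}) ∧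
    Nonempty (COML.{u} ≌ TJPAWStar.{u}) :=
  ⟨⟨comlToTJPCBoolean.asEquivalence⟩, ⟨projFunctor.asEquivalence.symm⟩,
    ⟨comlToTJPCBoolean.asEquivalence.trans projFunctor.asEquivalence.symm⟩⟩
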